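/- **Setting.** Consider a multistage stochastic program with stages $0,\dots,T$, $T\ge 1$, that is stagewise independent: the set $\tilde{\mathcal N}(t+1)$ of children of a node of stage $t$, with their data and transition probabilities $p_{t,m}>0$, $\sum_m p_{t,m}=1$, is finite and the same for all nodes of stage $t$. The root $r$ has a compact feasibility set $\mathcal F_r$ of pairs $(x,y)$ and a lower semicontinuous (l.s.c.) cost $f_r(y,x)\in[0,+\infty]$. Every node $m\in\tilde{\mathcal N}(t)$, $t\ge1$, has a compact feasibility set $\mathcal F_m$ of pairs $(x,y)$ and an l.s.c. cost $f_m(z,y,x)\in[0,+\infty]$, where $z$ is the state of the parent. States $x$ of stage $t$ lie in a $d_t$-dimensional normed space. The state space $\mathcal X_t$ is the set of the $x$ with $(x,y)\in\mathcal F_m$ for some $y$; it is the same for all nodes $m$ of stage $t$ when $1\le t\le T-1$ (and is that of the root for $t=0$). Some choice of decisions on the whole scenario tree has finite expected cost. For $m\in\tilde{\mathcal N}(t+1)$ let $\psi_m\ge0$ be a penalty function (zero exactly at $0$, level sets $\{\psi_m\le a\}$ with diameter tending to $0$ as $a\to0^+$) which is $1$-Lipschitz on $\mathcal X_t-\mathcal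 X_t$, let $\sigma_m>0$, and let $l_{m,\lambda},l_{m,\rho}\ge0$. Assume that either the problem is convex, all $\psi_m=\|\cdot\|$, $l_{m,\lambda}\ge\sigma_m$ and $l_{m,\rho}=0$ for all $m$, or $l_{m,\rho}\ge\sigma_m$ for all $m$. Convex means that all feasibility sets and costs (on $\mathcal F_r$, resp. $\mathcal X_t\times\mathcal F_m$) and all $\psi_m$ (on $\mathcal X_t-\mathcal X_t$) are convex. Define $\mathcal Q^{\mathrm R}_T=0$ and, for $t<T$, $$\mathcal Q^{\mathrm R}_t(x)=\sum_{m\in\tilde{\mathcal N}(t+1)}p_{t,m}\min_{(x',y)\in\mathcal F_m,\ z\in\mathcal X_t}\bigl\{f_m(z,y,x')+\sigma_m\psi_m(x-z)+\mathcal Q^{\mathrm R}_{t+1}(x')\bigr\}.$$ Let $v^{\mathrm{reg}}=\min_{(x,y)\in\mathcal F_r}\{f_r(y,x)+\mathcal Q_0^{\mathrm R}(x)\}$. A pair $(x,y)\in\mathcal F_r$ is an *$\epsilon$-optimal root solution* if $f_r(y,x)+\mathcal Q_0^{\mathrm R}(x)\le v^{\mathrm{reg}}+\epsilon$. Assume that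 the penalty reformulation is exact: every optimal solution of $$\min\ \sum_n p_n\bigl(f_n(z_n,y_n,x_n)+\sigma_n\psi_n(x_{a(n)}-z_n)\bigr),$$ over all nodes $n$ of the full scenario tree (no local copy and no penalty at the root), subject to $(x_n,y_n)\in\mathcal F_n$ and $z_n\in\mathcal X_{a(n)}$, has $z_n=x_{a(n)}$ for all $n\ne r$. Here $p_n$ is the probability of $n$ and $a(n)$ its parent. **Algorithm (deterministic sampling dual dynamic programming).** For $m\in\tilde{\mathcal N}(t+1)$, a state $\bar x\in\mathcal X_t$ and an l.s.c. function $\Theta$, the forward oracle $\mathscr O^{\mathrm F}_m(\bar x,\Theta)$ returns some minimizer $(x,y,z)$ of $f_m(z,y,x)+\sigma_m\psi_m(\bar x-z)+\Theta(x)$ over $(x,y)\in\mathcal F_m$, $z\in\mathcal X_t$. The backward oracle $\mathscr O^{\mathrm B}_m(\bar x,\Theta)$ returns some optimal solution $(\hat x,\hat y,\hat z;\hat\lambda,\hat\rho)$ of $$\max_{\|\lambda\|_*\le l_{m,\lambda},\ 0\le\rho\le l_{m,\rho}}\ \min_{(x,y)\in\mathcal F_m,\ z\in\mathcal X_t}\{f_m(z,y,x)+\langle\lambda,\bar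 x-z\rangle+\rho\psi_m(\bar x-z)+\Theta(x)\}.$$ The root oracle $\mathscr O_r(\Theta)$ returns some minimizer of $f_r(y,x)+\Theta(x)$ over $\mathcal F_r$. Start with $\underline{\mathcal Q}^0_t=0$ for all $t$, $\overline{\mathcal Q}^0_t=+\infty$ for $t<T$, $\overline{\mathcal Q}^0_T=0$, $(x_0^1,y_0^1)=\mathscr O_r(0)$, $\mathrm{LB}=f_r(y_0^1,x_0^1)$, $\mathrm{UB}=+\infty$. While $\mathrm{UB}-\mathrm{LB}>\epsilon$, do iteration $i=1,2,\dots$: * *Forward step.* For $t=1,\dots,T$ and $m\in\tilde{\mathcal N}(t)$ let $(x_m^i,y_m^i,z_m^i)=\mathscr O_m^{\mathrm F}(x_{t-1}^i,\underline{\mathcal Q}_t^{i-1})$. For $t<T$ let $x_t^i=x_m^i$ for some $m\in\tilde{\mathcal N}(t)$ with the largest gap $\overline{\mathcal Q}_t^{i-1}(x_m^i)-\underline{\mathcal Q}_t^{i-1}(x_m^i)$. * *Backward step.* Put $\underline{\mathcal Q}_T^i=\overline{\mathcal Q}_T^i=0$. For $t=T-1,\dots,0$ and $m\in\tilde{\mathcal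 N}(t+1)$ let $(\hat x,\hat y,\hat z;\hat\lambda,\hat\rho)=\mathscr O_m^{\mathrm B}(x_t^i,\underline{\mathcal Q}_{t+1}^i)$, let $\underline v_m^i=f_m(\hat z,\hat y,\hat x)+\langle\hat\lambda,x_t^i-\hat z\rangle+\hat\rho\psi_m(x_t^i-\hat z)+\underline{\mathcal Q}_{t+1}^i(\hat x)$, $C_m^i(x)=\underline v_m^i-\langle\hat\lambda,x_t^i-x\rangle-\hat\rho\psi_m(x_t^i-x)$ and $\overline v_m^i=f_m(z_m^i,y_m^i,x_m^i)+\sigma_m\psi_m(x_t^i-z_m^i)+\overline{\mathcal Q}_{t+1}^i(x_m^i)$. Then set $\underline{\mathcal Q}_t^i=\max\{\underline{\mathcal Q}_t^{i-1},\sum_mp_{t,m}C_m^i\}$, and obtain $\overline{\mathcal Q}_t^i$ from $\overline{\mathcal Q}_t^{i-1}$ and $\sum_mp_{t,m}(\overline v_m^i+\sigma_m\|\cdot-x_t^i\|)$ as the convex biconjugate of their pointwise minimum if the problem is convex, and as their pointwise minimum otherwise. * *Root update.* Let $(x_0^{i+1},y_0^{i+1})=\mathscr O_r(\underline{\mathcal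 Q}_0^i)$ and $\mathrm{LB}=f_r(y_0^{i+1},x_0^{i+1})+\underline{\mathcal Q}_0^i(x_0^{i+1})$. If $f_r(y_0^{i+1},x_0^{i+1})+\overline{\mathcal Q}_0^i(x_0^{i+1})<\mathrm{UB}$, replace $\mathrm{UB}$ by this value and the incumbent $(x_0^*,y_0^*)$ by $(x_0^{i+1},y_0^{i+1})$. **Claim.** Let $\epsilon>0$, $L_t=\sum_{m\in\tilde{\mathcal N}(t+1)}p_{t,m}(l_{m,\lambda}+l_{m,\rho})$, and let $D_t$ be the diameter of the smallest ball containing $\mathcal X_t$. Suppose $L_t\le L$, $D_t\le D$ and $d_t\le d$ for $0\le t\le T-1$. Then, for every choice of the oracles and of the selected nodes, the algorithm terminates, its incumbent $(x_0^*,y_0^*)$ is then an $\epsilon$-optimal root solution, and the number $i$ of its iterations satisfies $$i\le T\left(1+\frac{2LDT}{\epsilon}\right)^d .$$ For fixed $L,D,d,\epsilon$ this bound is $O(T^{d+1})$ as $T\to\infty$. -/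

import Mathlib

open scoped NNReal ENNReal Topology

noncomputable section

universe u v w w'

/-- Convexity (on the set `s`) of a function with values in `[0, +∞]`. -/
def ExtConvexOn {V : Type*} [AddCommGroup V] [Module ℝ V] (s : Set V) (g : V → ℝ≥0∞) : Prop :=
  Convex ℝ s ∧ ∀ ⦃u⦄, u ∈ s → ∀ ⦃v⦄, v ∈ s → ∀ a b : ℝ≥0, a + b = 1 →
    g ((a : ℝ) • u + (b : ℝ) • v) ≤ a * g u + b * g v

/-- A penalty function on a normed space: nonnegative, vanishing exactly at `0`, and with level
sets `{ψ ≤ a}` whose diameter tends to `0` as `a → 0`. -/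
structure IsPenalty {V : Type*} [NormedAddCommGroup V] (ψ : V → ℝ) : Prop where
  nonneg : ∀ x, 0 ≤ ψ x
  eq_zero_iff : ∀ x, ψ x = 0 ↔ x = 0
  level_diam : Filter.Tendsto (fun a : ℝ => Metric.ediam {x | ψ x ≤ a}) (𝓝[>] 0) (𝓝 0)

/-- The diameter of the smallest closed ball that contains `S`. -/
def enclosingDiam {V : Type*} [NormedAddCommGroup V] (S : Set V) : ℝ :=
  sInf {D : ℝ | 0 ≤ D ∧ ∃ c : V, S ⊆ Metric.closedBall c (D / 2)}

/-- The convex hull operation `conv{f, g} = (min{f, g})**`, through convex conjugacy. -/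
def convHullFun {V : Type*} [NormedAddCommGroup V] [NormedSpace ℝ V] (f g : V → EReal) (x : V) :
    EReal :=
  ⨆ lam : V →L[ℝ] ℝ, ⨅ z : V, min (f z) (g z) + ((lam (x - z) : ℝ) : EReal)

/-- The nodes of stage `t` of the scenario tree of a stagewise independent problem: the sequences
of children chosen in the stages `1, …, t`.  Here `C s` is the set of children of any node of
stage `s`.  The only node of stage `0` is the root. -/
abbrev TreeNode (C : ℕ → Type v) (t : ℕ) : Type v := (s : Fin t) → C s

/-- The parent node. -/
def TreeNode.parent {C : ℕ → Type v} {t : ℕ} (h : TreeNode C (t + 1)) : TreeNode C t :=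
  fun s => h s.castSucc

/-- The element of the recombining tree which carries the data of a non-root node. -/
def TreeNode.last {C : ℕ → Type v} {t : ℕ} (h : TreeNode C (t + 1)) : C t :=
  h (Fin.last t)

/-- The data of a stagewise independent multistage stochastic program with stages `0, …, T`,
given by its recombining scenario tree, together with the penalty functions and parameters.

* `E t` is the space of the state variables of stage `t`;
* `C t` is the set of the nodes of stage `t + 1` of the recombining tree, that is, of the children
  of any node of stage `t`;
* `Yr` and `Y t m` are the spaces of the internal variables of the root and of the node `m : C t`.

Everything attached to indices `t ≥ T` is irrelevant. -/
structure StagewiseProblem (E : ℕ → Type u) (C : ℕ → Type v) (Yr : Type w)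
    (Y : (t : ℕ) → C t → Type w') where
  /-- the index of the last stage -/
  T : ℕ
  /-- the transition probability from any node of stage `t` to its child `m` -/
  p : (t : ℕ) → C t → ℝ≥0
  /-- the feasibility set of the root, a set of pairs `(x, y)` -/
  Fr : Set (E 0 × Yr)
  /-- the nodal cost function of the root (the dummy parent state is `0`), at `(x, y)` -/
  fr : E 0 × Yr → ℝ≥0∞
  /-- the feasibility set of the node `m` of stage `t + 1`, a set of pairs `(x, y)` -/
  F : (t : ℕ) → (m : C t) → Set (E (t + 1) × Y t m)
  /-- the nodal cost function of the node `m` of stage `t + 1`, at `z` and `(x, y)` -/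
  f : (t : ℕ) → (m : C t) → E t → E (t + 1) × Y t m → ℝ≥0∞
  /-- the penalty functions -/
  ψ : (t : ℕ) → C t → E t → ℝ
  /-- the penalty parameters -/
  σ : (t : ℕ) → C t → ℝ
  /-- the bound on the norm of the linear dual variable -/
  lLam : (t : ℕ) → C t → ℝ
  /-- the bound on the dual variable of the penalty term -/
  lRho : (t : ℕ) → C t → ℝ

/-- Decisions `(x_n, y_n)` for all nodes `n` of the scenario tree. -/
structure TreePlan (E : ℕ → Type u) (C : ℕ → Type v) (Yr : Type w)
    (Y : (t : ℕ) → C t → Type w') where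
  root : E 0 × Yr
  dec : (t : ℕ) → (h : TreeNode C (t + 1)) → E (t + 1) × Y t h.last

/-- The state variable `x_n` of the node `n` under a plan. -/
def TreePlan.state {E : ℕ → Type u} {C : ℕ → Type v} {Yr : Type w}
    {Y : (t : ℕ) → C t → Type w'} (π : TreePlan E C Yr Y) : (t : ℕ) → TreeNode C t → E t
  | 0, _ => π.root.1
  | t + 1, h => (π.dec t h).1

namespace StagewiseProblem

variable {E : ℕ → Type u} {C : ℕ → Type v} {Yr : Type w} {Y : (t : ℕ) → C t → Type w'}

/-- The state space of the node `m` of stage `t + 1`. -/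
def nodeStateSpace (P : StagewiseProblem E C Yr Y) (t : ℕ) (m : C t) : Set (E (t + 1)) :=
  Prod.fst '' P.F t m

/-- The state space of stage `t`; for `1 ≤ t ≤ T - 1` it is the common state space of the nodes
of stage `t`. -/
def stateSpace (P : StagewiseProblem E C Yr Y) : (t : ℕ) → Set (E t)
  | 0 => Prod.fst '' P.Fr
  | t + 1 => ⋃ m : C t, P.nodeStateSpace t m

/-! ### The extensive formulations -/

/-- `(x_n, y_n) ∈ F_n` for all nodes `n` of the scenario tree. -/
def Feasible (P : StagewiseProblem E C Yr Y) (π : TreePlan E C Yr Y) : Prop :=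
  π.root ∈ P.Fr ∧ ∀ t < P.T, ∀ h : TreeNode C (t + 1), π.dec t h ∈ P.F t h.last

/-- The probability of a node of the scenario tree. -/
def prob (P : StagewiseProblem E C Yr Y) {t : ℕ} (h : TreeNode C t) : ℝ≥0 :=
  ∏ s : Fin t, P.p s (h s)

/-- The objective of the extensive formulation. -/
def primCost [∀ t, Fintype (C t)] (P : StagewiseProblem E C Yr Y) (π : TreePlan E C Yr Y) :
    ℝ≥0∞ :=
  P.fr π.root + ∑ t ∈ Finset.range P.T, ∑ h : TreeNode C (t + 1),
    (P.prob h : ℝ≥0∞) * P.f t h.last (π.state t h.parent) (π.dec t h)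

/-- The objective of the penalty reformulation; `z t h` is the local copy at the node `h` of the
state variable of its parent. -/
def penCost [∀ t, Fintype (C t)] [∀ t, NormedAddCommGroup (E t)] (P : StagewiseProblem E C Yr Y)
    (π : TreePlan E C Yr Y) (z : (t : ℕ) → TreeNode C (t + 1) → E t) : ℝ≥0∞ :=
  P.fr π.root + ∑ t ∈ Finset.range P.T, ∑ h : TreeNode C (t + 1),
    (P.prob h : ℝ≥0∞) * (P.f t h.last (z t h) (π.dec t h) +
      ENNReal.ofReal (P.σ t h.last * P.ψ t h.last (π.state t h.parent - z t h)))

/-- Feasibility in the penalty reformulation. -/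
def PenFeasible (P : StagewiseProblem E C Yr Y) (π : TreePlan E C Yr Y)
    (z : (t : ℕ) → TreeNode C (t + 1) → E t) : Prop :=
  P.Feasible π ∧ ∀ t < P.T, ∀ h : TreeNode C (t + 1), z t h ∈ P.stateSpace t

/-- The penalty reformulation is exact: in every optimal solution of it, each local copy agrees
with the state of the parent node. -/
def ExactPenalty [∀ t, Fintype (C t)] [∀ t, NormedAddCommGroup (E t)]
    (P : StagewiseProblem E C Yr Y) : Prop :=
  ∀ π z, P.PenFeasible π z → (∀ π' z', P.PenFeasible π' z' → P.penCost π z ≤ P.penCost π' z') →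
    ∀ t < P.T, ∀ h : TreeNode C (t + 1), z t h = π.state t h.parent

/-! ### Assumptions on the data -/

variable [∀ t, NormedAddCommGroup (E t)] [∀ t, NormedSpace ℝ (E t)] [∀ t, Fintype (C t)]
  [NormedAddCommGroup Yr] [NormedSpace ℝ Yr]
  [∀ t m, NormedAddCommGroup (Y t m)] [∀ t m, NormedSpace ℝ (Y t m)]

/-- The standing assumptions: positive transition probabilities which sum up to one, a common
state space for the nodes of each of the stages `1, …, T - 1`, compact feasibility sets, lower
semicontinuous cost functions, a plan of finite cost, positive penalty parameters, penalty
functions that are `1`-Lipschitz on differences of states, and nonnegative dual bounds. -/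
structure Admissible (P : StagewiseProblem E C Yr Y) : Prop where
  p_pos : ∀ t < P.T, ∀ m, 0 < P.p t m
  p_sum : ∀ t < P.T, ∑ m, P.p t m = 1
  same_states : ∀ t, t + 1 < P.T → ∀ m m', P.nodeStateSpace t m = P.nodeStateSpace t m'
  compact_root : IsCompact P.Fr
  compact_node : ∀ t < P.T, ∀ m, IsCompact (P.F t m)
  lsc_root : LowerSemicontinuousOn P.fr P.Fr
  lsc_node : ∀ t < P.T, ∀ m, LowerSemicontinuousOn
    (fun q : E t × (E (t + 1) × Y t m) => P.f t m q.1 q.2) (P.stateSpace t ×ˢ P.F t m)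
  proper : ∃ π, P.Feasible π ∧ P.primCost π < ⊤
  penalty : ∀ t < P.T, ∀ m, IsPenalty (P.ψ t m)
  penalty_lip : ∀ t < P.T, ∀ m, LipschitzOnWith 1 (P.ψ t m)
    {x | ∃ a ∈ P.stateSpace t, ∃ b ∈ P.stateSpace t, x = a - b}
  σ_pos : ∀ t < P.T, ∀ m, 0 < P.σ t m
  lLam_nonneg : ∀ t < P.T, ∀ m, 0 ≤ P.lLam t m
  lRho_nonneg : ∀ t < P.T, ∀ m, 0 ≤ P.lRho t m

/-- The (regularized) problem is convex. -/
structure IsConvex (P : StagewiseProblem E C Yr Y) : Prop where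
  root : ExtConvexOn P.Fr P.fr
  node : ∀ t < P.T, ∀ m, ExtConvexOn (P.stateSpace t ×ˢ P.F t m)
    (fun q : E t × (E (t + 1) × Y t m) => P.f t m q.1 q.2)
  penalty : ∀ t < P.T, ∀ m,
    ConvexOn ℝ {x | ∃ a ∈ P.stateSpace t, ∃ b ∈ P.stateSpace t, x = a - b} (P.ψ t m)

/-- The requirement on the bounds of the dual variables: either the problem is convex with norm
penalties, the cuts are linear and `σ ≤ lLam`, or `σ ≤ lRho`. -/
def DualBounds (P : StagewiseProblem E C Yr Y) : Prop :=
  (P.IsConvex ∧ ∀ t < P.T, ∀ m,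
      (∀ x, P.ψ t m x = ‖x‖) ∧ P.σ t m ≤ P.lLam t m ∧ P.lRho t m = 0) ∨
    ∀ t < P.T, ∀ m, P.σ t m ≤ P.lRho t m

/-- The constant `L_t`. -/
def lipConst (P : StagewiseProblem E C Yr Y) (t : ℕ) : ℝ :=
  ∑ m, (P.p t m : ℝ) * (P.lLam t m + P.lRho t m)

/-! ### Regularized value functions and `ε`-optimality -/

/-- The regularized expected cost-to-go function of stage `t` when `k` further stages follow. -/
def regCostAux (P : StagewiseProblem E C Yr Y) : ℕ → (t : ℕ) → E t → ℝ≥0∞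
  | 0, _, _ => 0
  | k + 1, t, x => ∑ m, (P.p t m : ℝ≥0∞) * ⨅ q ∈ P.F t m, ⨅ z ∈ P.stateSpace t,
      (P.f t m z q + ENNReal.ofReal (P.σ t m * P.ψ t m (x - z)) + regCostAux P k (t + 1) q.1)

/-- The regularized expected cost-to-go function of stage `t`. -/
def regCost (P : StagewiseProblem E C Yr Y) (t : ℕ) : E t → ℝ≥0∞ := P.regCostAux (P.T - t) t

/-- The optimal value of the regularized root problem. -/
def vReg (P : StagewiseProblem E C Yr Y) : ℝ≥0∞ := ⨅ q ∈ P.Fr, (P.fr q + P.regCost 0 q.1)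

/-- `ε`-optimal root node solutions of the regularized problem. -/
def EpsOptimal (P : StagewiseProblem E C Yr Y) (ε : ℝ) (q : E 0 × Yr) : Prop :=
  q ∈ P.Fr ∧ P.fr q + P.regCost 0 q.1 ≤ P.vReg + ENNReal.ofReal ε

/-! ### Subproblem oracles -/

/-- The objective of the forward subproblem of the node `m` of stage `t + 1`. -/
def fwdObj (P : StagewiseProblem E C Yr Y) (t : ℕ) (m : C t) (xbar : E t) (Θ : E (t + 1) → ℝ)
    (q : E (t + 1) × Y t m) (z : E t) : EReal :=
  (P.f t m z q : EReal) + ((P.σ t m * P.ψ t m (xbar - z) + Θ q.1 : ℝ) : EReal)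

/-- The inner objective of the backward subproblem of the node `m` of stage `t + 1`. -/
def bwdObj (P : StagewiseProblem E C Yr Y) (t : ℕ) (m : C t) (xbar : E t) (Θ : E (t + 1) → ℝ)
    (lam : E t →L[ℝ] ℝ) (ρ : ℝ) (q : E (t + 1) × Y t m) (z : E t) : EReal :=
  (P.f t m z q : EReal) + ((lam (xbar - z) + ρ * P.ψ t m (xbar - z) + Θ q.1 : ℝ) : EReal)

/-- The inner minimum of the backward subproblem. -/
def dualVal (P : StagewiseProblem E C Yr Y) (t : ℕ) (m : C t) (xbar : E t) (Θ : E (t + 1) → ℝ)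
    (lam : E t →L[ℝ] ℝ) (ρ : ℝ) : EReal :=
  ⨅ q ∈ P.F t m, ⨅ z ∈ P.stateSpace t, P.bwdObj t m xbar Θ lam ρ q z

/-- The set of the dual variables `(λ, ρ)`. -/
def dualSet (P : StagewiseProblem E C Yr Y) (t : ℕ) (m : C t) : Set ((E t →L[ℝ] ℝ) × ℝ) :=
  {u | ‖u.1‖ ≤ P.lLam t m ∧ 0 ≤ u.2 ∧ u.2 ≤ P.lRho t m}

end StagewiseProblem

/-- The solution `(x, y, z)` returned by a forward oracle, with `xy = (x, y)`. -/
structure FwdSol (X Z W : Type*) where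
  xy : X × W
  z : Z

/-- The solution `(x, y, z; λ, ρ)` returned by a backward oracle, with `xy = (x, y)`. -/
structure BwdSol (X Z W : Type*) [NormedAddCommGroup Z] [NormedSpace ℝ Z] where
  xy : X × W
  z : Z
  lam : Z →L[ℝ] ℝ
  ρ : ℝ

/-- The subproblem oracles of the root (`root`), of the forward steps (`fwd`) and of the backward
steps (`bwd`), and the rule `sel i t` which selects in iteration `i` a node of stage `t + 1` from
the approximation gaps of the nodes of that stage (indices `t ≥ T` are irrelevant). -/
structure Oracles (E : ℕ → Type u) (C : ℕ → Type v) (Yr : Type w) (Y : (t : ℕ) → C t → Type w')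
    [∀ t, NormedAddCommGroup (E t)] [∀ t, NormedSpace ℝ (E t)] where
  root : (E 0 → ℝ) → E 0 × Yr
  fwd : (t : ℕ) → (m : C t) → E t → (E (t + 1) → ℝ) → FwdSol (E (t + 1)) (E t) (Y t m)
  bwd : (t : ℕ) → (m : C t) → E t → (E (t + 1) → ℝ) → BwdSol (E (t + 1)) (E t) (Y t m)
  sel : ℕ → (t : ℕ) → (C t → EReal) → C t

/-- The variables of the algorithm between two iterations: the current under- (`lo`) and
over-approximations (`hi`) of the expected cost-to-go functions, the root solution for the next
iteration, the bounds, and the incumbent solution (if there is one already). -/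
structure AlgState (E : ℕ → Type u) (Yr : Type w) where
  lo : (t : ℕ) → E t → ℝ
  hi : (t : ℕ) → E t → EReal
  cur : E 0 × Yr
  lb : EReal
  ub : EReal
  best : Option (E 0 × Yr)

namespace StagewiseProblem

variable {E : ℕ → Type u} {C : ℕ → Type v} {Yr : Type w} {Y : (t : ℕ) → C t → Type w'}
  [∀ t, NormedAddCommGroup (E t)] [∀ t, NormedSpace ℝ (E t)] [∀ t, Fintype (C t)]
  [NormedAddCommGroup Yr] [NormedSpace ℝ Yr]
  [∀ t m, NormedAddCommGroup (Y t m)] [∀ t m, NormedSpace ℝ (Y t m)]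

/-- The oracles return optimal solutions of their subproblems, for all lower semicontinuous `Θ`,
and the selected node has a largest approximation gap. -/
structure ValidOracles (P : StagewiseProblem E C Yr Y) (O : Oracles E C Yr Y) : Prop where
  root : ∀ Θ : E 0 → ℝ, LowerSemicontinuousOn Θ (P.stateSpace 0) →
    O.root Θ ∈ P.Fr ∧ ∀ q ∈ P.Fr, (P.fr (O.root Θ) : EReal) + (Θ (O.root Θ).1 : EReal) ≤
      (P.fr q : EReal) + (Θ q.1 : EReal)
  fwd : ∀ t < P.T, ∀ m, ∀ xbar ∈ P.stateSpace t, ∀ Θ : E (t + 1) → ℝ,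
    LowerSemicontinuousOn Θ (P.nodeStateSpace t m) →
    (O.fwd t m xbar Θ).xy ∈ P.F t m ∧ (O.fwd t m xbar Θ).z ∈ P.stateSpace t ∧
      ∀ q ∈ P.F t m, ∀ z ∈ P.stateSpace t,
        P.fwdObj t m xbar Θ (O.fwd t m xbar Θ).xy (O.fwd t m xbar Θ).z ≤
          P.fwdObj t m xbar Θ q z
  bwd : ∀ t < P.T, ∀ m, ∀ xbar ∈ P.stateSpace t, ∀ Θ : E (t + 1) → ℝ,
    LowerSemicontinuousOn Θ (P.nodeStateSpace t m) →
    ((O.bwd t m xbar Θ).lam, (O.bwd t m xbar Θ).ρ) ∈ P.dualSet t m ∧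
      (∀ u ∈ P.dualSet t m, P.dualVal t m xbar Θ u.1 u.2 ≤
        P.dualVal t m xbar Θ (O.bwd t m xbar Θ).lam (O.bwd t m xbar Θ).ρ) ∧
      (O.bwd t m xbar Θ).xy ∈ P.F t m ∧ (O.bwd t m xbar Θ).z ∈ P.stateSpace t ∧
      ∀ q ∈ P.F t m, ∀ z ∈ P.stateSpace t,
        P.bwdObj t m xbar Θ (O.bwd t m xbar Θ).lam (O.bwd t m xbar Θ).ρ
            (O.bwd t m xbar Θ).xy (O.bwd t m xbar Θ).z ≤
          P.bwdObj t m xbar Θ (O.bwd t m xbar Θ).lam (O.bwd t m xbar Θ).ρ q z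
  sel : ∀ i, ∀ t < P.T, ∀ γ : C t → EReal, ∀ m, γ m ≤ γ (O.sel i t γ)

/-! ### The algorithm -/

/-- The initialization. -/
def algInit (P : StagewiseProblem E C Yr Y) (O : Oracles E C Yr Y) : AlgState E Yr where
  lo := fun _ _ => 0
  hi := fun t _ => if t < P.T then ⊤ else 0
  cur := O.root (fun _ => 0)
  lb := (P.fr (O.root (fun _ => 0)) : EReal)
  ub := ⊤
  best := none

/-- The state `x_t` of stage `t` obtained in the forward step of iteration `i`, which starts from
the values `s` of the variables. -/
def fwdState (O : Oracles E C Yr Y) (i : ℕ) (s : AlgState E Yr) : (t : ℕ) → E t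
  | 0 => s.cur.1
  | t + 1 =>
    let sol := fun m : C t => O.fwd t m (fwdState O i s t) (s.lo (t + 1))
    let gap := fun m : C t =>
      s.hi (t + 1) (sol m).xy.1 - (s.lo (t + 1) (sol m).xy.1 : EReal)
    (sol (O.sel i t gap)).xy.1

/-- The constant term of the cut of the node `m` of stage `t + 1`, where `Θ` is the updated
under-approximation of stage `t + 1` (the cost is finite at the solution of the oracle). -/
def cutVal (P : StagewiseProblem E C Yr Y) (O : Oracles E C Yr Y) (t : ℕ) (m : C t) (xbar : E t)
    (Θ : E (t + 1) → ℝ) : ℝ :=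
  let b := O.bwd t m xbar Θ
  (P.f t m b.z b.xy).toReal + b.lam (xbar - b.z) + b.ρ * P.ψ t m (xbar - b.z) + Θ b.xy.1

/-- The generalized conjugacy cut of the node `m` of stage `t + 1`, as a function of `x`. -/
def cut (P : StagewiseProblem E C Yr Y) (O : Oracles E C Yr Y) (t : ℕ) (m : C t) (xbar : E t)
    (Θ : E (t + 1) → ℝ) (x : E t) : ℝ :=
  let b := O.bwd t m xbar Θ
  P.cutVal O t m xbar Θ - b.lam (xbar - x) - b.ρ * P.ψ t m (xbar - x)

/-- The updated under-approximation of stage `t` when `k` further stages follow. -/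
def newUnderAux (P : StagewiseProblem E C Yr Y) (O : Oracles E C Yr Y) (i : ℕ)
    (s : AlgState E Yr) : ℕ → (t : ℕ) → E t → ℝ
  | 0, _, _ => 0
  | k + 1, t, x => max (s.lo t x)
      (∑ m, (P.p t m : ℝ) * P.cut O t m (fwdState O i s t) (newUnderAux P O i s k (t + 1)) x)

open Classical in
/-- The updated over-approximation of stage `t` when `k` further stages follow. -/
def newOverAux (P : StagewiseProblem E C Yr Y) (O : Oracles E C Yr Y) (i : ℕ)
    (s : AlgState E Yr) : ℕ → (t : ℕ) → E t → EReal
  | 0, _ => fun _ => 0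
  | k + 1, t =>
    let xt := fwdState O i s t
    let sol := fun m : C t => O.fwd t m xt (s.lo (t + 1))
    let vbar := fun m : C t => (P.f t m (sol m).z (sol m).xy : EReal) +
      ((P.σ t m * P.ψ t m (xt - (sol m).z) : ℝ) : EReal) +
      newOverAux P O i s k (t + 1) (sol m).xy.1
    let g := fun x : E t => ∑ m, ((P.p t m : ℝ) : EReal) *
      (vbar m + ((P.σ t m * ‖x - xt‖ : ℝ) : EReal))
    if P.IsConvex then convHullFun (s.hi t) g else fun x => min (s.hi t x) (g x)

open Classical in
/-- Iteration `i`: forward step, backward step and root node update. -/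
def algStep (P : StagewiseProblem E C Yr Y) (O : Oracles E C Yr Y) (i : ℕ)
    (s : AlgState E Yr) : AlgState E Yr :=
  let lo := fun t => P.newUnderAux O i s (P.T - t) t
  let hi := fun t => P.newOverAux O i s (P.T - t) t
  let q := O.root (lo 0)
  let cand := (P.fr q : EReal) + hi 0 q.1
  { lo := lo
    hi := hi
    cur := q
    lb := (P.fr q : EReal) + (lo 0 q.1 : EReal)
    ub := if cand < s.ub then cand else s.ub
    best := if cand < s.ub then some q else s.best }

/-- The variables of the algorithm at the end of iteration `i` (for `i = 0`: after the
initialization), when the stopping criterion is ignored. -/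
def algRun (P : StagewiseProblem E C Yr Y) (O : Oracles E C Yr Y) : ℕ → AlgState E Yr
  | 0 => P.algInit O
  | i + 1 => P.algStep O (i + 1) (algRun P O i)

/-- The algorithm terminates at the end of iteration `i`: this is the first time that the loop
condition `ub - lb > ε` fails. -/
def TerminatesAt (P : StagewiseProblem E C Yr Y) (O : Oracles E C Yr Y) (ε : ℝ) (i : ℕ) : Prop :=
  (P.algRun O i).ub - (P.algRun O i).lb ≤ (ε : EReal) ∧
    ∀ j < i, (ε : EReal) < (P.algRun O j).ub - (P.algRun O j).lb

end StagewiseProblem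

end

/-! Two families of bounds are maintained. The over-approximations `hi` stay above the regularized
cost-to-go. The under-approximations `lo` need not stay below it: the dual bounds may exceed `σ`, so
a cut only underestimates the value with the local copy fixed at the parent state. What survives is
the one-step inequality `Invariant.lo_sub` for the unpenalized problem. Telescoped over the scenario
tree, it puts the root under-approximation below the cost of every feasible plan. Exactness of the
penalty produces a feasible plan of cost `vReg`, so the lower bound never exceeds `vReg`
(`Invariant.lb_le_vReg`), and an incumbent that passes the stopping test is `ε`-optimal.

In the convex case the biconjugate could destroy the upper bound. It does not, because at every
state the regularized value of a node has a subgradient of norm at most `σ`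
(`exists_nodeSubgradient`, by Hahn-Banach). The resulting affine functions lie below every cone
added to `hi`, on the whole space, and so they pass to the convex hull (`newOver_convex_of_succ`).

The iteration count rests on `newOver_le_newUnder_add`. The backward dual is at least as good as the
forward problem (`le_cutVal`), so a gap of at most `c` at the forward solutions of stage `t + 1`
leaves, after the iteration, a gap of at most `c + 2 * L_t * ‖x - x_t‖` at every state `x` of stage
`t`.

Put `δ = ε / T`. While the algorithm runs, the gap at the current root state exceeds `T * δ`,
whereas it is `0` at stage `T`. Hence each iteration has a stage `t` whose gap exceeds `(T - t) * δ`
while the gap of the next stage is at most `(T - t - 1) * δ`. Two iterations with the same `t` have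
states at distance at least `δ / (2 * L)`, since otherwise the earlier one would already have closed
the gap at the later state. A volume comparison bounds the number of such states for each stage, and
summing over the `T` stages gives the bound. -/

noncomputable section

universe u v w w'

set_option linter.unusedSectionVars false

/-! ### Separation by a functional of bounded norm -/

/-- Separation of a convex set from the region strictly below a cone `v - σ ‖x - ·‖`. -/
theorem exists_linear_minorant {V : Type*} [NormedAddCommGroup V] [NormedSpace ℝ V]
    {K : Set (V × ℝ)} (hK : Convex ℝ K) {v σ : ℝ} (hσ : 0 ≤ σ) {x : V}
    (h : ∀ k ∈ K, v - σ * ‖x - k.1‖ ≤ k.2) :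
    ∃ l : V →L[ℝ] ℝ, ‖l‖ ≤ σ ∧ ∀ k ∈ K, v ≤ k.2 + l (x - k.1) := by
  rcases K.eq_empty_or_nonempty with rfl | ⟨k₀, hk₀⟩
  · exact ⟨0, by simpa using hσ, by simp⟩
  set U : Set (V × ℝ) := {k | k.2 < v - σ * ‖x - k.1‖} with hU
  have hUo : IsOpen U := isOpen_lt (by fun_prop) (by fun_prop)
  have hUc : Convex ℝ U := by
    intro a ha b hb s t hs ht hst
    simp only [hU, Set.mem_ofPred_eq, Prod.fst_add, Prod.smul_fst, Prod.snd_add, Prod.smul_snd,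
      smul_eq_mul] at *
    have e : x - (s • a.1 + t • b.1) = s • (x - a.1) + t • (x - b.1) := by
      have : x = s • x + t • x := by rw [← add_smul, hst, one_smul]
      nth_rewrite 1 [this]
      simp only [smul_sub]
      abel
    have hn : ‖x - (s • a.1 + t • b.1)‖ ≤ s * ‖x - a.1‖ + t * ‖x - b.1‖ := by
      rw [e]
      refine (norm_add_le _ _).trans_eq ?_
      rw [norm_smul, norm_smul, Real.norm_of_nonneg hs, Real.norm_of_nonneg ht]
    have hn' := mul_le_mul_of_nonneg_left hn hσ
    have key : s * a.2 + t * b.2 < s * (v - σ * ‖x - a.1‖) + t * (v - σ * ‖x - b.1‖) := by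
      rcases hs.eq_or_lt with rfl | hs'
      · have : t = 1 := by linarith
        subst this
        linarith
      · have h1 := mul_lt_mul_of_pos_left ha hs'
        have h2 := mul_le_mul_of_nonneg_left hb.le ht
        linarith
    have : s * v + t * v = v := by rw [← add_mul, hst, one_mul]
    nlinarith
  have hdisj : Disjoint U K := by
    rw [Set.disjoint_left]
    intro k hk hk'
    exact absurd (h k hk') (not_le.2 hk)
  obtain ⟨F, u, hFU, hFK⟩ := geometric_hahn_banach_open hUc hUo hK hdisj
  set μ : V →L[ℝ] ℝ := F.comp (ContinuousLinearMap.inl ℝ V ℝ) with hμ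
  set c : ℝ := F (0, 1) with hc
  have hF : ∀ k : V × ℝ, F k = μ k.1 + c * k.2 := by
    intro k
    have : k = (k.1, (0 : ℝ)) + k.2 • ((0 : V), (1 : ℝ)) := by ext <;> simp
    conv_lhs => rw [this, map_add, map_smul]
    simp [hμ, hc, mul_comm]
  have hlow : ∀ z s, s < v - σ * ‖x - z‖ → μ z + c * s < u := by
    intro z s hs
    have := hFU (z, s) hs
    rwa [hF] at this
  have hup : ∀ k ∈ K, u ≤ μ k.1 + c * k.2 := by
    intro k hk
    have := hFK k hk
    rwa [hF] at this
  -- The region `U` contains points arbitrarily far below `k₀`; with `c ≤ 0` such a point could not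
  -- be separated from `k₀`.
  have hcpos : 0 < c := by
    by_contra hcn
    push Not at hcn
    set s := min k₀.2 (v - σ * ‖x - k₀.1‖ - 1)
    have h1 := hlow k₀.1 s (by have := min_le_right k₀.2 (v - σ * ‖x - k₀.1‖ - 1); grind)
    have h2 := hup k₀ hk₀
    have h3 : s ≤ k₀.2 := min_le_left _ _
    nlinarith
  have hlim : ∀ z, μ z + c * (v - σ * ‖x - z‖) ≤ u := by
    intro z
    refine le_of_forall_pos_lt_add fun e he => ?_
    have := hlow z (v - σ * ‖x - z‖ - e / c) (by have := div_pos he hcpos; linarith)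
    have h2 : c * (e / c) = e := by field_simp
    nlinarith
  -- The apex `(x, v)` is a limit of points of `U`, so `μ x + c * v ≤ u ≤ μ k.1 + c * k.2` on `K`;
  -- dividing by `c` gives this functional.
  refine ⟨-(c⁻¹ • μ), ?_, ?_⟩
  · have hx := hlim x
    -- If `μ` grew faster than the cone falls in a direction `w`, the bound `u` would fail at `x + n
    -- • w` for large `n`.
    have half : ∀ w, μ w ≤ c * (σ * ‖w‖) := by
      intro w
      by_contra hw
      push Not at hw
      set g := μ w - c * (σ * ‖w‖) with hg
      have hgpos : 0 < g := by linarith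
      obtain ⟨n, hn⟩ := exists_nat_gt ((u - μ x - c * v) / g)
      rw [div_lt_iff₀ hgpos] at hn
      have := hlim (x + (n : ℝ) • w)
      rw [sub_add_cancel_left, norm_neg, norm_smul, map_add, map_smul, smul_eq_mul,
        Real.norm_of_nonneg (Nat.cast_nonneg n)] at this
      rw [hg] at hn
      nlinarith
    refine ContinuousLinearMap.opNorm_le_bound _ hσ fun w => ?_
    have h1 := half w
    have h2 := half (-w)
    rw [map_neg, norm_neg] at h2
    have : ‖μ w‖ ≤ c * (σ * ‖w‖) := by
      rw [Real.norm_eq_abs]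
      exact abs_le.2 ⟨by linarith, h1⟩
    rw [neg_apply, norm_neg, smul_apply, norm_smul,
      Real.norm_of_nonneg (inv_nonneg.2 hcpos.le), inv_mul_le_iff₀ hcpos]
    exact this
  · intro k hk
    have h1 := hup k hk
    have h2 := hlim x
    simp only [sub_self, norm_zero, mul_zero, sub_zero] at h2
    have h3 : c * v ≤ c * k.2 - (μ x - μ k.1) := by linarith
    have h4 : c⁻¹ * (c * v) ≤ c⁻¹ * (c * k.2 - (μ x - μ k.1)) :=
      mul_le_mul_of_nonneg_left h3 (inv_nonneg.2 hcpos.le)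
    rw [inv_mul_cancel_left₀ hcpos.ne', mul_sub, inv_mul_cancel_left₀ hcpos.ne'] at h4
    simp only [neg_apply, smul_apply, map_sub,
      smul_eq_mul]
    rw [mul_sub] at h4
    linarith

/-! ### Packing by comparison of volumes -/

/-- The number of `r`-separated points in a ball of diameter `D`. -/
theorem card_le_of_separated_of_subset_closedBall {V ι : Type*} [NormedAddCommGroup V]
    [NormedSpace ℝ V] [FiniteDimensional ℝ V] (s : Finset ι) (x : ι → V) {D r : ℝ} (hD : 0 ≤ D)
    (hr : 0 < r) (c : V) (hx : ∀ i ∈ s, x i ∈ Metric.closedBall c (D / 2))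
    (hsep : ∀ i ∈ s, ∀ j ∈ s, i ≠ j → r ≤ ‖x i - x j‖) :
    (s.card : ℝ) ≤ (1 + D / r) ^ Module.finrank ℝ V := by
  borelize V
  let μ : MeasureTheory.Measure V := MeasureTheory.Measure.addHaar
  have hr2 : 0 < r / 2 := by positivity
  have hR : 0 ≤ D / 2 + r / 2 := by positivity
  -- The balls of radius `r / 2` around the points are disjoint and fit into a ball of radius `D / 2
  -- + r / 2`. By scaling of Haar measure their number is at most the quotient of these radii to the
  -- power of the dimension.
  have hdisj : (s : Set ι).PairwiseDisjoint fun i => Metric.ball (x i) (r / 2) := by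
    intro i hi j hj hij
    refine Metric.ball_disjoint_ball ?_
    rw [dist_eq_norm]
    linarith [hsep i hi j hj hij]
  have hsub : (⋃ i ∈ s, Metric.ball (x i) (r / 2)) ⊆ Metric.ball c (D / 2 + r / 2) := by
    refine Set.iUnion₂_subset fun i hi => ?_
    refine Metric.ball_subset_ball' ?_
    have := hx i hi
    rw [Metric.mem_closedBall] at this
    linarith
  have hm : ∑ i ∈ s, μ (Metric.ball (x i) (r / 2)) ≤ μ (Metric.ball c (D / 2 + r / 2)) := by
    rw [← MeasureTheory.measure_biUnion_finset hdisj fun i _ => Metric.isOpen_ball.measurableSet]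
    exact MeasureTheory.measure_mono hsub
  have e1 : ∀ i, μ (Metric.ball (x i) (r / 2)) =
      ENNReal.ofReal ((r / 2) ^ Module.finrank ℝ V) * μ (Metric.ball 0 1) := fun i =>
    MeasureTheory.Measure.addHaar_ball_of_pos μ (x i) hr2
  have hR' : 0 < D / 2 + r / 2 := by positivity
  rw [Finset.sum_congr rfl fun i _ => e1 i, Finset.sum_const, nsmul_eq_mul,
    MeasureTheory.Measure.addHaar_ball_of_pos μ c hR', ← mul_assoc] at hm
  have hball0 : μ (Metric.ball (0 : V) 1) ≠ 0 :=
    (Metric.measure_ball_pos μ 0 one_pos).ne'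
  have hballt : μ (Metric.ball (0 : V) 1) ≠ ⊤ := MeasureTheory.measure_ball_lt_top.ne
  rw [ENNReal.mul_le_mul_iff_left hball0 hballt, ← ENNReal.ofReal_natCast,
    ← ENNReal.ofReal_mul (Nat.cast_nonneg _), ENNReal.ofReal_le_ofReal_iff (by positivity)] at hm
  have hp : 0 < (r / 2) ^ Module.finrank ℝ V := by positivity
  have e2 : (1 + D / r) ^ Module.finrank ℝ V =
      (D / 2 + r / 2) ^ Module.finrank ℝ V / (r / 2) ^ Module.finrank ℝ V := by
    rw [← div_pow]
    congr 1
    field_simp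
    ring
  rw [e2, le_div_iff₀ hp]
  exact hm

theorem enclosingDiam_nonneg {V : Type*} [NormedAddCommGroup V] (S : Set V) :
    0 ≤ enclosingDiam S :=
  Real.sInf_nonneg fun _ h => h.1

/-- The number of `r`-separated points of a bounded set in terms of its enclosing diameter. -/
theorem card_le_of_separated_of_enclosingDiam {V ι : Type*} [NormedAddCommGroup V]
    [NormedSpace ℝ V] [FiniteDimensional ℝ V] {S : Set V} (hS : Bornology.IsBounded S)
    (s : Finset ι) (x : ι → V) {r : ℝ} (hr : 0 < r) (hx : ∀ i ∈ s, x i ∈ S)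
    (hsep : ∀ i ∈ s, ∀ j ∈ s, i ≠ j → r ≤ ‖x i - x j‖) :
    (s.card : ℝ) ≤ (1 + enclosingDiam S / r) ^ Module.finrank ℝ V := by
  have hne : {D : ℝ | 0 ≤ D ∧ ∃ c : V, S ⊆ Metric.closedBall c (D / 2)}.Nonempty := by
    obtain ⟨R, hR⟩ := hS.subset_closedBall (0 : V)
    refine ⟨2 * max R 0, by positivity, 0, hR.trans (Metric.closedBall_subset_closedBall ?_)⟩
    rw [mul_div_cancel_left₀ _ (two_ne_zero)]
    exact le_max_left _ _
  -- No attainment of the infimum is needed: the estimate holds for every larger `D` and passes to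
  -- the limit from the right.
  have hlim : Filter.Tendsto (fun D : ℝ => (1 + D / r) ^ Module.finrank ℝ V)
      (𝓝[>] (enclosingDiam S)) (𝓝 ((1 + enclosingDiam S / r) ^ Module.finrank ℝ V)) := by
    have : Continuous fun D : ℝ => (1 + D / r) ^ Module.finrank ℝ V := by fun_prop
    exact (this.tendsto _).mono_left nhdsWithin_le_nhds
  refine ge_of_tendsto hlim (Filter.eventually_of_mem self_mem_nhdsWithin fun D hD => ?_)
  obtain ⟨D', ⟨hD'0, c, hc⟩, hD'⟩ := exists_lt_of_csInf_lt hne hD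
  refine (card_le_of_separated_of_subset_closedBall s x hD'0 hr c (fun i hi => hc (hx i hi))
    hsep).trans ?_
  gcongr

/-- For `N ≥ 1` the base is at most `(1 + |a / ε|) * N` in absolute value. -/
theorem isBigO_mul_one_add_div_pow (a ε : ℝ) (d : ℕ) :
    Asymptotics.IsBigO Filter.atTop (fun N : ℕ => (N : ℝ) * (1 + a * N / ε) ^ d)
      (fun N : ℕ => (N : ℝ) ^ (d + 1)) := by
  refine Asymptotics.IsBigO.of_bound ((1 + |a / ε|) ^ d) ?_
  filter_upwards [Filter.eventually_ge_atTop 1] with N hN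
  have hN' : (1 : ℝ) ≤ N := by exact_mod_cast hN
  have hb : |1 + a * N / ε| ≤ (1 + |a / ε|) * N := by
    have e : 1 + a * N / ε = 1 + a / ε * N := by ring
    rw [e]
    refine (abs_add_le _ _).trans ?_
    rw [abs_one, abs_mul, Nat.abs_cast, add_mul, one_mul]
    linarith
  rw [norm_mul, norm_pow, norm_pow, Real.norm_eq_abs, Real.norm_eq_abs, Nat.abs_cast]
  calc (N : ℝ) * |1 + a * N / ε| ^ d ≤ N * ((1 + |a / ε|) * N) ^ d := by gcongr
    _ = (1 + |a / ε|) ^ d * (N : ℝ) ^ (d + 1) := by rw [mul_pow, pow_succ]; ring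

/-! ### Sums over the scenario tree -/

namespace TreeNode

variable {C : ℕ → Type v}

/-- The child of a node given by an element of the recombining tree. -/
def child {t : ℕ} (h : TreeNode C t) (m : C t) : TreeNode C (t + 1) :=
  Fin.snoc (α := fun s : Fin (t + 1) => C s) h m

@[simp] theorem parent_child {t : ℕ} (h : TreeNode C t) (m : C t) : (h.child m).parent = h := by
  funext s
  exact Fin.snoc_castSucc (α := fun s : Fin (t + 1) => C s) m h s

@[simp] theorem last_child {t : ℕ} (h : TreeNode C t) (m : C t) : (h.child m).last = m :=
  Fin.snoc_last (α := fun s : Fin (t + 1) => C s) m h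

@[simp] theorem child_parent_last {t : ℕ} (h : TreeNode C (t + 1)) : h.parent.child h.last = h :=
  Fin.snoc_init_self (α := fun s : Fin (t + 1) => C s) h

/-- A non-root node is given by its parent and its element of the recombining tree. -/
def childEquiv (t : ℕ) : TreeNode C t × C t ≃ TreeNode C (t + 1) where
  toFun a := a.1.child a.2
  invFun h := (h.parent, h.last)
  left_inv a := by simp
  right_inv h := by simp

theorem sum_succ [∀ t, Fintype (C t)] {t : ℕ} {M : Type*} [AddCommMonoid M]
    (g : TreeNode C (t + 1) → M) : ∑ h, g h = ∑ h : TreeNode C t, ∑ m, g (h.child m) := by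
  rw [← (childEquiv t).sum_comp, Fintype.sum_prod_type]
  rfl

end TreeNode

namespace StagewiseProblem

variable {E : ℕ → Type u} {C : ℕ → Type v} {Yr : Type w} {Y : (t : ℕ) → C t → Type w'}

theorem prob_child (P : StagewiseProblem E C Yr Y) {t : ℕ} (h : TreeNode C t) (m : C t) :
    P.prob (h.child m) = P.prob h * P.p t m := by
  unfold prob
  rw [Fin.prod_univ_castSucc]
  congr 1
  · refine Finset.prod_congr rfl fun s _ => ?_
    rw [show h.child m s.castSucc = h s from congrFun (TreeNode.parent_child h m) s]
    rfl
  · rw [show h.child m (Fin.last t) = m from TreeNode.last_child h m]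
    rfl

variable [∀ t, Fintype (C t)]

theorem tree_sum_step (P : StagewiseProblem E C Yr Y) (t : ℕ) (w : TreeNode C (t + 1) → ℝ≥0∞) :
    ∑ h, (P.prob h : ℝ≥0∞) * w h =
      ∑ h : TreeNode C t, (P.prob h : ℝ≥0∞) * ∑ m, (P.p t m : ℝ≥0∞) * w (h.child m) := by
  rw [TreeNode.sum_succ]
  refine Finset.sum_congr rfl fun h _ => ?_
  rw [Finset.mul_sum]
  refine Finset.sum_congr rfl fun m _ => ?_
  rw [prob_child, ENNReal.coe_mul, mul_assoc]

/-- Telescoping of a one-stage inequality over the scenario tree. -/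
theorem le_tree_sum (P : StagewiseProblem E C Yr Y) (w : (t : ℕ) → TreeNode C t → ℝ≥0∞)
    (c : (t : ℕ) → TreeNode C (t + 1) → ℝ≥0∞) (k : ℕ)
    (hw : ∀ t < k, ∀ h : TreeNode C t,
      w t h ≤ ∑ m, (P.p t m : ℝ≥0∞) * (c t (h.child m) + w (t + 1) (h.child m))) (h₀ : TreeNode C 0) :
    w 0 h₀ ≤ ∑ t ∈ Finset.range k, ∑ h : TreeNode C (t + 1), (P.prob h : ℝ≥0∞) * c t h +
      ∑ h : TreeNode C k, (P.prob h : ℝ≥0∞) * w k h := by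
  induction k with
  | zero => simp [prob, Subsingleton.elim default h₀]
  | succ k ih =>
    refine (ih fun t ht => hw t (ht.trans k.lt_succ_self)).trans ?_
    rw [Finset.sum_range_succ, add_assoc]
    gcongr
    calc ∑ h : TreeNode C k, (P.prob h : ℝ≥0∞) * w k h
        ≤ ∑ h : TreeNode C k, (P.prob h : ℝ≥0∞) *
            ∑ m, (P.p k m : ℝ≥0∞) * (c k (h.child m) + w (k + 1) (h.child m)) := by
          gcongr with h
          exact hw k k.lt_succ_self h
      _ = _ := by
          rw [← P.tree_sum_step k fun h => c k h + w (k + 1) h, ← Finset.sum_add_distrib]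
          simp only [mul_add]

theorem tree_sum_le (P : StagewiseProblem E C Yr Y) (w : (t : ℕ) → TreeNode C t → ℝ≥0∞)
    (c : (t : ℕ) → TreeNode C (t + 1) → ℝ≥0∞) (k : ℕ)
    (hw : ∀ t < k, ∀ h : TreeNode C t,
      ∑ m, (P.p t m : ℝ≥0∞) * (c t (h.child m) + w (t + 1) (h.child m)) ≤ w t h) (h₀ : TreeNode C 0) :
    ∑ t ∈ Finset.range k, ∑ h : TreeNode C (t + 1), (P.prob h : ℝ≥0∞) * c t h +
      ∑ h : TreeNode C k, (P.prob h : ℝ≥0∞) * w k h ≤ w 0 h₀ := by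
  induction k with
  | zero => simp [prob, Subsingleton.elim default h₀]
  | succ k ih =>
    refine le_trans ?_ (ih fun t ht => hw t (ht.trans k.lt_succ_self))
    rw [Finset.sum_range_succ, add_assoc]
    gcongr
    calc _ = ∑ h : TreeNode C k, (P.prob h : ℝ≥0∞) *
            ∑ m, (P.p k m : ℝ≥0∞) * (c k (h.child m) + w (k + 1) (h.child m)) := by
          rw [← P.tree_sum_step k fun h => c k h + w (k + 1) h, ← Finset.sum_add_distrib]
          simp only [mul_add]
      _ ≤ ∑ h : TreeNode C k, (P.prob h : ℝ≥0∞) * w k h := by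
          gcongr with h
          exact hw k k.lt_succ_self h

end StagewiseProblem

namespace StagewiseProblem

variable {E : ℕ → Type u} {C : ℕ → Type v} {Yr : Type w} {Y : (t : ℕ) → C t → Type w'}
  [∀ t, NormedAddCommGroup (E t)] [∀ t, NormedSpace ℝ (E t)] [∀ t, Fintype (C t)]
  [NormedAddCommGroup Yr] [NormedSpace ℝ Yr]
  [∀ t m, NormedAddCommGroup (Y t m)] [∀ t m, NormedSpace ℝ (Y t m)]

variable {P : StagewiseProblem E C Yr Y} {O : Oracles E C Yr Y}

/-! ### Consequences of the standing assumptions -/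

theorem Admissible.nonempty_children (hP : P.Admissible) {t : ℕ} (ht : t < P.T) :
    Nonempty (C t) := by
  by_contra h
  rw [not_nonempty_iff] at h
  simpa using hP.p_sum t ht

theorem Admissible.sum_p (hP : P.Admissible) {t : ℕ} (ht : t < P.T) :
    ∑ m, (P.p t m : ℝ) = 1 := by
  exact_mod_cast hP.p_sum t ht

theorem Admissible.sum_p_mul_add (hP : P.Admissible) {t : ℕ} (ht : t < P.T) (g : C t → ℝ)
    (c : ℝ) : ∑ m, (P.p t m : ℝ) * (g m + c) = ∑ m, (P.p t m : ℝ) * g m + c := by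
  simp only [mul_add, Finset.sum_add_distrib]
  rw [← Finset.sum_mul, hP.sum_p ht, one_mul]

theorem nodeStateSpace_subset (P : StagewiseProblem E C Yr Y) (t : ℕ) (m : C t) :
    P.nodeStateSpace t m ⊆ P.stateSpace (t + 1) :=
  Set.subset_iUnion (fun m => P.nodeStateSpace t m) m

theorem fst_mem_stateSpace {t : ℕ} {m : C t} {q : E (t + 1) × Y t m} (hq : q ∈ P.F t m) :
    q.1 ∈ P.stateSpace (t + 1) :=
  P.nodeStateSpace_subset t m ⟨q, hq, rfl⟩

theorem Admissible.prob_pos (hP : P.Admissible) {t : ℕ} (ht : t ≤ P.T) (h : TreeNode C t) :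
    0 < P.prob h :=
  Finset.prod_pos fun s _ => hP.p_pos s (s.2.trans_le ht) _

theorem Feasible.state_mem {π : TreePlan E C Yr Y} (hπ : P.Feasible π) :
    ∀ t < P.T, ∀ h : TreeNode C t, π.state t h ∈ P.stateSpace t
  | 0, _, _ => ⟨π.root, hπ.1, rfl⟩
  | t + 1, ht, h => fst_mem_stateSpace (hπ.2 t (t.lt_succ_self.trans ht) h)

theorem Admissible.exists_treeNode (hP : P.Admissible) :
    ∀ t ≤ P.T, Nonempty (TreeNode C t)
  | 0, _ => ⟨fun s => s.elim0⟩
  | t + 1, ht => by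
    obtain ⟨h⟩ := hP.exists_treeNode t (t.le_succ.trans ht)
    obtain ⟨m⟩ := hP.nonempty_children (t := t) ht
    exact ⟨h.child m⟩

theorem Admissible.exists_root_finite (hP : P.Admissible) : ∃ q ∈ P.Fr, P.fr q ≠ ⊤ := by
  obtain ⟨π, hπ, hc⟩ := hP.proper
  exact ⟨π.root, hπ.1, (ENNReal.add_lt_top.1 hc).1.ne⟩

/-- In a plan of finite expected cost no node of positive probability can have infinite cost, and
every element of the recombining tree occurs at such a node. -/
theorem Admissible.exists_node_finite (hP : P.Admissible) {t : ℕ} (ht : t < P.T) (m : C t) :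
    ∃ z ∈ P.stateSpace t, ∃ q ∈ P.F t m, P.f t m z q ≠ ⊤ := by
  obtain ⟨π, hπ, hc⟩ := hP.proper
  obtain ⟨h⟩ := hP.exists_treeNode t ht.le
  have h2 := (ENNReal.add_lt_top.1 hc).2
  rw [ENNReal.sum_lt_top] at h2
  have h3 := h2 t (Finset.mem_range.2 ht)
  rw [ENNReal.sum_lt_top] at h3
  have h4 := h3 (h.child m) (Finset.mem_univ _)
  have h5 : P.f t (h.child m).last (π.state t (h.child m).parent) (π.dec t (h.child m)) ≠ ⊤ := by
    intro h6
    rw [h6, ENNReal.mul_top] at h4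
    · exact lt_irrefl _ h4
    · simpa using (hP.prob_pos ht (h.child m)).ne'
  have hst := hπ.state_mem t ht (h.child m).parent
  have hdec := hπ.2 t ht (h.child m)
  generalize π.state t (h.child m).parent = z at *
  generalize π.dec t (h.child m) = q at *
  rw [TreeNode.last_child] at q
  -- The decision lives in the space of `(h.child m).last`, which equals `m` only propositionally; a
  -- variable `m'` allows the transport.
  have key : ∀ m', m' = m → ∀ q : E (t + 1) × Y t m', q ∈ P.F t m' → P.f t m' z q ≠ ⊤ →
      ∃ z ∈ P.stateSpace t, ∃ q ∈ P.F t m, P.f t m z q ≠ ⊤ := by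
    rintro m' rfl q hq hf
    exact ⟨z, hst, q, hq, hf⟩
  exact key _ (TreeNode.last_child h m) _ hdec h5

theorem Admissible.pen_nonneg (hP : P.Admissible) {t : ℕ} (ht : t < P.T) (m : C t) (x : E t) :
    0 ≤ P.σ t m * P.ψ t m x :=
  mul_nonneg (hP.σ_pos t ht m).le ((hP.penalty t ht m).nonneg x)

theorem Admissible.psi_zero (hP : P.Admissible) {t : ℕ} (ht : t < P.T) (m : C t) :
    P.ψ t m 0 = 0 :=
  ((hP.penalty t ht m).eq_zero_iff 0).2 rfl

theorem Admissible.psi_sub_le (hP : P.Admissible) {t : ℕ} (ht : t < P.T) (m : C t) {x x' z : E t}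
    (hx : x ∈ P.stateSpace t) (hx' : x' ∈ P.stateSpace t) (hz : z ∈ P.stateSpace t) :
    P.ψ t m (x - z) ≤ P.ψ t m (x' - z) + ‖x - x'‖ := by
  have := (hP.penalty_lip t ht m).le_add_mul (x := x - z) (y := x' - z) ⟨x, hx, z, hz, rfl⟩
    ⟨x', hx', z, hz, rfl⟩
  rw [dist_eq_norm, sub_sub_sub_cancel_right, NNReal.coe_one, one_mul] at this
  exact this

theorem Admissible.psi_le_norm (hP : P.Admissible) {t : ℕ} (ht : t < P.T) (m : C t) {x x' : E t}
    (hx : x ∈ P.stateSpace t) (hx' : x' ∈ P.stateSpace t) :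
    P.ψ t m (x - x') ≤ ‖x - x'‖ := by
  have := hP.psi_sub_le ht m hx hx' hx'
  rwa [sub_self, hP.psi_zero ht m, zero_add] at this

/-! ### The regularized value functions -/

/-- The optimal value of the regularized subproblem of the node `m` of stage `t + 1`. -/
def nodeReg (P : StagewiseProblem E C Yr Y) (t : ℕ) (m : C t) (x : E t) : ℝ≥0∞ :=
  ⨅ q ∈ P.F t m, ⨅ z ∈ P.stateSpace t,
    (P.f t m z q + ENNReal.ofReal (P.σ t m * P.ψ t m (x - z)) + P.regCost (t + 1) q.1)

theorem regCost_of_lt {t : ℕ} (ht : t < P.T) (x : E t) :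
    P.regCost t x = ∑ m, (P.p t m : ℝ≥0∞) * P.nodeReg t m x := by
  have : P.T - t = P.T - (t + 1) + 1 := by omega
  unfold regCost nodeReg
  rw [this]
  rfl

theorem regCost_last (x : E P.T) : P.regCost P.T x = 0 := by
  unfold regCost
  rw [Nat.sub_self]
  rfl

theorem nodeReg_le {t : ℕ} {m : C t} {q : E (t + 1) × Y t m} (hq : q ∈ P.F t m) {z : E t}
    (hz : z ∈ P.stateSpace t) (x : E t) : P.nodeReg t m x ≤
      P.f t m z q + ENNReal.ofReal (P.σ t m * P.ψ t m (x - z)) + P.regCost (t + 1) q.1 :=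
  (iInf₂_le q hq).trans (iInf₂_le z hz)

theorem Admissible.regCost_ne_top (hP : P.Admissible) {t : ℕ} (ht : t ≤ P.T) :
    ∀ x, P.regCost t x ≠ ⊤ := by
  induction ht using Nat.decreasingInduction with
  | self => intro x; simp [regCost_last]
  | of_succ t ht ih =>
    intro x
    rw [regCost_of_lt ht]
    refine (ENNReal.sum_lt_top.2 fun m _ => ENNReal.mul_lt_top ENNReal.coe_lt_top ?_).ne
    obtain ⟨z, hz, q, hq, hf⟩ := hP.exists_node_finite ht m
    exact (nodeReg_le hq hz x).trans_lt (ENNReal.add_lt_top.2 ⟨ENNReal.add_lt_top.2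
      ⟨hf.lt_top, ENNReal.ofReal_lt_top⟩, (ih q.1).lt_top⟩)

theorem Admissible.nodeReg_ne_top (hP : P.Admissible) {t : ℕ} (ht : t < P.T) (m : C t) (x : E t) :
    P.nodeReg t m x ≠ ⊤ := by
  obtain ⟨z, hz, q, hq, hf⟩ := hP.exists_node_finite ht m
  exact ((nodeReg_le hq hz x).trans_lt (ENNReal.add_lt_top.2 ⟨ENNReal.add_lt_top.2
    ⟨hf.lt_top, ENNReal.ofReal_lt_top⟩, (hP.regCost_ne_top ht q.1).lt_top⟩)).ne

/-- The real value of `nodeReg`. -/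
def nodeVal (P : StagewiseProblem E C Yr Y) (t : ℕ) (m : C t) (x : E t) : ℝ :=
  (P.nodeReg t m x).toReal

/-- The real value of `regCost`. -/
def regVal (P : StagewiseProblem E C Yr Y) (t : ℕ) (x : E t) : ℝ := (P.regCost t x).toReal

theorem regVal_nonneg (t : ℕ) (x : E t) : 0 ≤ P.regVal t x := ENNReal.toReal_nonneg

theorem regVal_last (x : E P.T) : P.regVal P.T x = 0 := by
  simp [regVal, regCost_last]

theorem Admissible.regVal_of_lt (hP : P.Admissible) {t : ℕ} (ht : t < P.T) (x : E t) :
    P.regVal t x = ∑ m, (P.p t m : ℝ) * P.nodeVal t m x := by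
  unfold regVal nodeVal
  rw [regCost_of_lt ht, ENNReal.toReal_sum fun m _ =>
    ENNReal.mul_ne_top ENNReal.coe_ne_top (hP.nodeReg_ne_top ht m x)]
  simp

theorem Admissible.ofReal_regVal (hP : P.Admissible) {t : ℕ} (ht : t ≤ P.T) (x : E t) :
    ENNReal.ofReal (P.regVal t x) = P.regCost t x :=
  ENNReal.ofReal_toReal (hP.regCost_ne_top ht x)

theorem Admissible.nodeVal_le (hP : P.Admissible) {t : ℕ} (ht : t < P.T) {m : C t}
    {q : E (t + 1) × Y t m} (hq : q ∈ P.F t m) {z : E t} (hz : z ∈ P.stateSpace t)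
    (hf : P.f t m z q ≠ ⊤) (x : E t) : P.nodeVal t m x ≤
      (P.f t m z q).toReal + P.σ t m * P.ψ t m (x - z) + P.regVal (t + 1) q.1 := by
  have h := ENNReal.toReal_mono (ENNReal.add_ne_top.2 ⟨ENNReal.add_ne_top.2
    ⟨hf, ENNReal.ofReal_ne_top⟩, hP.regCost_ne_top ht q.1⟩) (nodeReg_le hq hz x)
  rwa [ENNReal.toReal_add (ENNReal.add_ne_top.2 ⟨hf, ENNReal.ofReal_ne_top⟩)
    (hP.regCost_ne_top ht q.1), ENNReal.toReal_add hf ENNReal.ofReal_ne_top,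
    ENNReal.toReal_ofReal (hP.pen_nonneg ht m _)] at h

/-- Only the penalty term depends on `x`, and it is `σ`-Lipschitz in `x` on the state space. This
regularity comes from the penalty alone; the costs are merely lower semicontinuous. -/
theorem Admissible.nodeReg_le_add (hP : P.Admissible) {t : ℕ} (ht : t < P.T) (m : C t)
    {x x' : E t} (hx : x ∈ P.stateSpace t) (hx' : x' ∈ P.stateSpace t) :
    P.nodeReg t m x ≤ P.nodeReg t m x' + ENNReal.ofReal (P.σ t m * ‖x - x'‖) := by
  rw [← tsub_le_iff_right]
  refine le_iInf₂ fun q hq => le_iInf₂ fun z hz => ?_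
  rw [tsub_le_iff_right]
  refine (nodeReg_le hq hz x).trans ?_
  have h : ENNReal.ofReal (P.σ t m * P.ψ t m (x - z)) ≤
      ENNReal.ofReal (P.σ t m * P.ψ t m (x' - z)) + ENNReal.ofReal (P.σ t m * ‖x - x'‖) := by
    have hs := (hP.σ_pos t ht m).le
    rw [← ENNReal.ofReal_add (hP.pen_nonneg ht m _) (by positivity), ← mul_add]
    exact ENNReal.ofReal_le_ofReal (mul_le_mul_of_nonneg_left (hP.psi_sub_le ht m hx hx' hz) hs)
  calc _ ≤ P.f t m z q + (ENNReal.ofReal (P.σ t m * P.ψ t m (x' - z)) +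
          ENNReal.ofReal (P.σ t m * ‖x - x'‖)) + P.regCost (t + 1) q.1 := by gcongr
    _ = _ := by ring

theorem Admissible.nodeVal_le_add (hP : P.Admissible) {t : ℕ} (ht : t < P.T) (m : C t)
    {x x' : E t} (hx : x ∈ P.stateSpace t) (hx' : x' ∈ P.stateSpace t) :
    P.nodeVal t m x ≤ P.nodeVal t m x' + P.σ t m * ‖x - x'‖ := by
  have h := ENNReal.toReal_mono (ENNReal.add_ne_top.2 ⟨hP.nodeReg_ne_top ht m x',
    ENNReal.ofReal_ne_top⟩) (hP.nodeReg_le_add ht m hx hx')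
  have hs := (hP.σ_pos t ht m).le
  rwa [ENNReal.toReal_add (hP.nodeReg_ne_top ht m x') ENNReal.ofReal_ne_top,
    ENNReal.toReal_ofReal (by positivity)] at h

theorem Admissible.continuousOn_nodeVal (hP : P.Admissible) {t : ℕ} (ht : t < P.T) (m : C t) :
    ContinuousOn (P.nodeVal t m) (P.stateSpace t) := by
  refine (LipschitzOnWith.of_le_add_mul (P.σ t m).toNNReal fun x hx y hy => ?_).continuousOn
  rw [Real.coe_toNNReal _ (hP.σ_pos t ht m).le, dist_eq_norm]
  exact hP.nodeVal_le_add ht m hx hy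

theorem Admissible.continuousOn_regVal (hP : P.Admissible) {t : ℕ} (ht : t ≤ P.T) :
    ContinuousOn (P.regVal t) (P.stateSpace t) := by
  rcases ht.eq_or_lt with rfl | ht
  · have : P.regVal P.T = fun _ => 0 := funext regVal_last
    rw [this]
    exact continuousOn_const
  · have : P.regVal t = fun x => ∑ m, (P.p t m : ℝ) * P.nodeVal t m x :=
      funext fun x => hP.regVal_of_lt ht x
    rw [this]
    exact continuousOn_finsetSum _ fun m _ => (hP.continuousOn_nodeVal ht m).const_mul _

theorem Admissible.fwdObj_regVal (hP : P.Admissible) {t : ℕ} (ht : t < P.T) (m : C t) (x : E t)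
    (q : E (t + 1) × Y t m) (z : E t) : P.fwdObj t m x (P.regVal (t + 1)) q z =
      ((P.f t m z q + ENNReal.ofReal (P.σ t m * P.ψ t m (x - z)) + P.regCost (t + 1) q.1 : ℝ≥0∞)
        : EReal) := by
  unfold fwdObj
  rw [← hP.ofReal_regVal ht, EReal.coe_ennreal_add, EReal.coe_ennreal_add,
    EReal.coe_ennreal_ofReal, EReal.coe_ennreal_ofReal, max_eq_left (hP.pen_nonneg ht m _),
    max_eq_left (regVal_nonneg _ _), EReal.coe_add, add_assoc]

/-- The forward oracle solves the regularized subproblem of a node. -/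
theorem ValidOracles.fwd_regVal (hO : P.ValidOracles O) (hP : P.Admissible) {t : ℕ} (ht : t < P.T)
    (m : C t) {x : E t} (hx : x ∈ P.stateSpace t) :
    (O.fwd t m x (P.regVal (t + 1))).xy ∈ P.F t m ∧
      (O.fwd t m x (P.regVal (t + 1))).z ∈ P.stateSpace t ∧
      P.f t m (O.fwd t m x (P.regVal (t + 1))).z (O.fwd t m x (P.regVal (t + 1))).xy +
        ENNReal.ofReal (P.σ t m * P.ψ t m (x - (O.fwd t m x (P.regVal (t + 1))).z)) +
        P.regCost (t + 1) (O.fwd t m x (P.regVal (t + 1))).xy.1 = P.nodeReg t m x := by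
  obtain ⟨h1, h2, h3⟩ := hO.fwd t ht m x hx (P.regVal (t + 1))
    ((hP.continuousOn_regVal ht).mono (P.nodeStateSpace_subset t m)).lowerSemicontinuousOn
  refine ⟨h1, h2, le_antisymm (le_iInf₂ fun q hq => le_iInf₂ fun z hz => ?_) (nodeReg_le h1 h2 x)⟩
  have := h3 q hq z hz
  rwa [hP.fwdObj_regVal ht, hP.fwdObj_regVal ht, EReal.coe_ennreal_le_coe_ennreal_iff] at this

/-- Attainment is read off from the forward oracle, applied to the continuous function `regVal`,
instead of a compactness argument. -/
theorem ValidOracles.exists_nodeVal_eq (hO : P.ValidOracles O) (hP : P.Admissible) {t : ℕ}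
    (ht : t < P.T) (m : C t) {x : E t} (hx : x ∈ P.stateSpace t) :
    ∃ q ∈ P.F t m, ∃ z ∈ P.stateSpace t, P.f t m z q ≠ ⊤ ∧ P.nodeVal t m x =
      (P.f t m z q).toReal + P.σ t m * P.ψ t m (x - z) + P.regVal (t + 1) q.1 := by
  obtain ⟨h1, h2, h3⟩ := hO.fwd_regVal hP ht m hx
  have hf : P.f t m (O.fwd t m x (P.regVal (t + 1))).z (O.fwd t m x (P.regVal (t + 1))).xy ≠ ⊤ := by
    intro hf
    rw [hf, top_add, top_add] at h3
    exact hP.nodeReg_ne_top ht m x h3.symm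
  refine ⟨_, h1, _, h2, hf, ?_⟩
  unfold nodeVal
  rw [← h3, ENNReal.toReal_add (ENNReal.add_ne_top.2 ⟨hf, ENNReal.ofReal_ne_top⟩)
    (hP.regCost_ne_top ht _), ENNReal.toReal_add hf ENNReal.ofReal_ne_top,
    ENNReal.toReal_ofReal (hP.pen_nonneg ht m _)]
  rfl

/-! ### Convexity of the regularized value functions -/

theorem IsConvex.convex_stateSpace (hc : P.IsConvex) (hP : P.Admissible) {t : ℕ} (ht : t < P.T) :
    Convex ℝ (P.stateSpace t) := by
  obtain ⟨m⟩ := hP.nonempty_children ht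
  obtain ⟨-, -, q, hq, -⟩ := hP.exists_node_finite ht m
  intro x hx y hy a b ha hb hab
  exact ((hc.node t ht m).1 (x := (x, q)) ⟨hx, hq⟩ (y := (y, q)) ⟨hy, hq⟩ ha hb hab).1

theorem IsConvex.convex_node (hc : P.IsConvex) (hP : P.Admissible) {t : ℕ} (ht : t < P.T)
    (m : C t) : Convex ℝ (P.F t m) := by
  obtain ⟨z, hz, -⟩ := hP.exists_node_finite ht m
  intro x hx y hy a b ha hb hab
  exact ((hc.node t ht m).1 (x := (z, x)) ⟨hz, hx⟩ (y := (z, y)) ⟨hz, hy⟩ ha hb hab).2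

theorem IsConvex.f_le (hc : P.IsConvex) {t : ℕ} (ht : t < P.T) {m : C t} {z₁ z₂ : E t}
    {q₁ q₂ : E (t + 1) × Y t m} (hz₁ : z₁ ∈ P.stateSpace t) (hz₂ : z₂ ∈ P.stateSpace t)
    (hq₁ : q₁ ∈ P.F t m) (hq₂ : q₂ ∈ P.F t m) (hf₁ : P.f t m z₁ q₁ ≠ ⊤) (hf₂ : P.f t m z₂ q₂ ≠ ⊤)
    {a b : ℝ} (ha : 0 ≤ a) (hb : 0 ≤ b) (hab : a + b = 1) :
    P.f t m (a • z₁ + b • z₂) (a • q₁ + b • q₂) ≠ ⊤ ∧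
      (P.f t m (a • z₁ + b • z₂) (a • q₁ + b • q₂)).toReal ≤
        a * (P.f t m z₁ q₁).toReal + b * (P.f t m z₂ q₂).toReal := by
  lift a to ℝ≥0 using ha
  lift b to ℝ≥0 using hb
  have h := (hc.node t ht m).2 (u := (z₁, q₁)) ⟨hz₁, hq₁⟩ (v := (z₂, q₂)) ⟨hz₂, hq₂⟩ a b
    (by exact_mod_cast hab)
  have h1 : (a : ℝ≥0∞) * P.f t m z₁ q₁ ≠ ⊤ := ENNReal.mul_ne_top ENNReal.coe_ne_top hf₁
  have h2 : (b : ℝ≥0∞) * P.f t m z₂ q₂ ≠ ⊤ := ENNReal.mul_ne_top ENNReal.coe_ne_top hf₂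
  refine ⟨(h.trans_lt (ENNReal.add_lt_top.2 ⟨h1.lt_top, h2.lt_top⟩)).ne, ?_⟩
  have h3 := ENNReal.toReal_mono (ENNReal.add_ne_top.2 ⟨h1, h2⟩) h
  rw [ENNReal.toReal_add h1 h2] at h3
  simpa using h3

/-- Partial minimization of a jointly convex function: the convex combination of minimizers at `x`
and `y` is a candidate at the combined state. -/
theorem ValidOracles.convexOn_nodeVal_of_succ (hO : P.ValidOracles O) (hP : P.Admissible)
    (hc : P.IsConvex) {t : ℕ} (ht : t < P.T)
    (h : ∀ u ∈ P.stateSpace (t + 1), ∀ v ∈ P.stateSpace (t + 1), ∀ a b : ℝ, 0 ≤ a → 0 ≤ b →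
      a + b = 1 → P.regVal (t + 1) (a • u + b • v) ≤
        a * P.regVal (t + 1) u + b * P.regVal (t + 1) v) (m : C t) :
    ConvexOn ℝ (P.stateSpace t) (P.nodeVal t m) := by
  refine ⟨hc.convex_stateSpace hP ht, fun x hx y hy a b ha hb hab => ?_⟩
  obtain ⟨q₁, hq₁, z₁, hz₁, hf₁, e₁⟩ := hO.exists_nodeVal_eq hP ht m hx
  obtain ⟨q₂, hq₂, z₂, hz₂, hf₂, e₂⟩ := hO.exists_nodeVal_eq hP ht m hy
  obtain ⟨hf, hle⟩ := hc.f_le ht hz₁ hz₂ hq₁ hq₂ hf₁ hf₂ ha hb hab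
  have h1 := hP.nodeVal_le ht (hc.convex_node hP ht m hq₁ hq₂ ha hb hab)
    (hc.convex_stateSpace hP ht hz₁ hz₂ ha hb hab) hf (a • x + b • y)
  have h2 := h q₁.1 (fst_mem_stateSpace hq₁) q₂.1 (fst_mem_stateSpace hq₂) a b ha hb hab
  have h3 := (hc.penalty t ht m).2 (x := x - z₁) ⟨x, hx, z₁, hz₁, rfl⟩ (y := y - z₂)
    ⟨y, hy, z₂, hz₂, rfl⟩ ha hb hab
  have e3 : a • (x - z₁) + b • (y - z₂) = a • x + b • y - (a • z₁ + b • z₂) := by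
    simp only [smul_sub]; abel
  rw [e3] at h3
  have h4 := mul_le_mul_of_nonneg_left h3 (hP.σ_pos t ht m).le
  simp only [smul_eq_mul, Prod.fst_add, Prod.smul_fst] at *
  rw [e₁, e₂]
  linarith

theorem ValidOracles.regVal_convex (hO : P.ValidOracles O) (hP : P.Admissible)
    (hc : P.IsConvex) {t : ℕ} (ht : t ≤ P.T) :
    ∀ u ∈ P.stateSpace t, ∀ v ∈ P.stateSpace t, ∀ a b : ℝ, 0 ≤ a → 0 ≤ b →
      a + b = 1 → P.regVal t (a • u + b • v) ≤ a * P.regVal t u + b * P.regVal t v := by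
  induction ht using Nat.decreasingInduction with
  | self => intros; simp [regVal_last]
  | of_succ t ht ih =>
    intro x hx y hy a b ha hb hab
    simp only [hP.regVal_of_lt ht]
    rw [Finset.mul_sum, Finset.mul_sum, ← Finset.sum_add_distrib]
    refine Finset.sum_le_sum fun m _ => ?_
    have h := (hO.convexOn_nodeVal_of_succ hP hc ht ih m).2 hx hy ha hb hab
    have h2 := mul_le_mul_of_nonneg_left h (P.p t m).2
    simp only [smul_eq_mul] at h2
    refine h2.trans_eq ?_
    simp only [NNReal.val_eq_coe]
    ring

theorem ValidOracles.convexOn_nodeVal (hO : P.ValidOracles O) (hP : P.Admissible)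
    (hc : P.IsConvex) {t : ℕ} (ht : t < P.T) (m : C t) :
    ConvexOn ℝ (P.stateSpace t) (P.nodeVal t m) :=
  hO.convexOn_nodeVal_of_succ hP hc ht (hO.regVal_convex hP hc ht) m

/-- `l` is a subgradient at `x`, of norm at most `σ`, of the regularized value function of a
node. -/
def IsNodeSubgradient (P : StagewiseProblem E C Yr Y) (t : ℕ) (m : C t) (x : E t)
    (l : E t →L[ℝ] ℝ) : Prop :=
  ‖l‖ ≤ P.σ t m ∧ ∀ z ∈ P.stateSpace t, P.nodeVal t m x + l (z - x) ≤ P.nodeVal t m z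

/-- The Lipschitz estimate keeps the epigraph above the downward cone of slope `σ` at `x`, so the
separating functional inherits the norm bound `σ`, even at boundary points of the state space. -/
theorem ValidOracles.exists_nodeSubgradient (hO : P.ValidOracles O) (hP : P.Admissible)
    (hc : P.IsConvex) {t : ℕ} (ht : t < P.T) (m : C t) {x : E t} (hx : x ∈ P.stateSpace t) :
    ∃ l, P.IsNodeSubgradient t m x l := by
  obtain ⟨l, hl, hl'⟩ := exists_linear_minorant (hO.convexOn_nodeVal hP hc ht m).convex_epigraph
    (hP.σ_pos t ht m).le (v := P.nodeVal t m x) (x := x) (by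
      rintro ⟨z, s⟩ ⟨hz, hs⟩
      have := hP.nodeVal_le_add ht m hx hz
      simp only at hs ⊢
      linarith)
  refine ⟨l, hl, fun z hz => ?_⟩
  have := hl' (z, P.nodeVal t m z) ⟨hz, le_rfl⟩
  simp only [map_sub] at this ⊢
  linarith

/-! ### Exactness of the penalty reformulation -/

/-- The states of the plan which solves the regularized subproblems by the forward oracles. -/
def regState (P : StagewiseProblem E C Yr Y) (O : Oracles E C Yr Y) :
    (t : ℕ) → TreeNode C t → E t
  | 0, _ => (O.root (P.regVal 0)).1
  | t + 1, h => (O.fwd t h.last (regState P O t h.parent) (P.regVal (t + 1))).xy.1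

/-- The plan which solves the regularized subproblems by the forward oracles. -/
def regPlan (P : StagewiseProblem E C Yr Y) (O : Oracles E C Yr Y) : TreePlan E C Yr Y where
  root := O.root (P.regVal 0)
  dec t h := (O.fwd t h.last (P.regState O t h.parent) (P.regVal (t + 1))).xy

theorem regPlan_state (t : ℕ) (h : TreeNode C t) :
    (P.regPlan O).state t h = P.regState O t h := by
  cases t <;> rfl

/-- The local copies that belong to `regPlan`. -/
def regCopy (P : StagewiseProblem E C Yr Y) (O : Oracles E C Yr Y) (t : ℕ)
    (h : TreeNode C (t + 1)) : E t :=
  (O.fwd t h.last (P.regState O t h.parent) (P.regVal (t + 1))).z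

theorem ValidOracles.root_regVal (hO : P.ValidOracles O) (hP : P.Admissible) :
    O.root (P.regVal 0) ∈ P.Fr ∧
      P.fr (O.root (P.regVal 0)) + P.regCost 0 (O.root (P.regVal 0)).1 = P.vReg := by
  obtain ⟨h1, h2⟩ := hO.root (P.regVal 0)
    (hP.continuousOn_regVal (Nat.zero_le _)).lowerSemicontinuousOn
  refine ⟨h1, le_antisymm (le_iInf₂ fun q hq => ?_) (iInf₂_le _ h1)⟩
  have h3 := h2 q hq
  have e : ∀ x : E 0, ((P.regVal 0 x : ℝ) : EReal) = (P.regCost 0 x : EReal) := by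
    intro x
    rw [← hP.ofReal_regVal (Nat.zero_le _), EReal.coe_ennreal_ofReal,
      max_eq_left (regVal_nonneg _ _)]
  rwa [e, e, ← EReal.coe_ennreal_add, ← EReal.coe_ennreal_add,
    EReal.coe_ennreal_le_coe_ennreal_iff] at h3

theorem ValidOracles.regState_mem (hO : P.ValidOracles O) (hP : P.Admissible) :
    ∀ t < P.T, ∀ h : TreeNode C t, P.regState O t h ∈ P.stateSpace t
  | 0, _, _ => ⟨_, (hO.root_regVal hP).1, rfl⟩
  | t + 1, ht, h => fst_mem_stateSpace (hO.fwd_regVal hP (t.lt_succ_self.trans ht) h.last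
      (hO.regState_mem hP t (t.lt_succ_self.trans ht) h.parent)).1

theorem ValidOracles.penFeasible_regPlan (hO : P.ValidOracles O) (hP : P.Admissible) :
    P.PenFeasible (P.regPlan O) (P.regCopy O) :=
  ⟨⟨(hO.root_regVal hP).1, fun t ht h =>
    (hO.fwd_regVal hP ht h.last (hO.regState_mem hP t ht h.parent)).1⟩, fun t ht h =>
    (hO.fwd_regVal hP ht h.last (hO.regState_mem hP t ht h.parent)).2.1⟩

/-- The decisions at a child are one candidate in its regularized subproblem; these inequalities
telescope over the tree. -/
theorem vReg_le_penCost {π : TreePlan E C Yr Y} {z : (t : ℕ) → TreeNode C (t + 1) → E t}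
    (h : P.PenFeasible π z) : P.vReg ≤ P.penCost π z := by
  refine (iInf₂_le π.root h.1.1).trans ?_
  unfold penCost
  gcongr
  have := P.le_tree_sum (fun t h => P.regCost t (π.state t h))
    (fun t h => P.f t h.last (z t h) (π.dec t h) +
      ENNReal.ofReal (P.σ t h.last * P.ψ t h.last (π.state t h.parent - z t h))) P.T
    (fun t ht n => by
      rw [regCost_of_lt ht]
      gcongr with m
      have h1 := nodeReg_le (P := P) (h.1.2 t ht (n.child m)) (h.2 t ht (n.child m)) (π.state t n)
      rw [TreeNode.parent_child]
      refine le_trans ?_ h1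
      rw [TreeNode.last_child]) (fun s => s.elim0)
  simp only [regCost_last, mul_zero, Finset.sum_const_zero, add_zero] at this
  exact this

/-- Along the plan built from oracle minimizers each dynamic programming inequality is an equality,
so the telescoping runs in the other direction. -/
theorem ValidOracles.penCost_regPlan_le (hO : P.ValidOracles O) (hP : P.Admissible) :
    P.penCost (P.regPlan O) (P.regCopy O) ≤ P.vReg := by
  rw [← (hO.root_regVal hP).2]
  unfold penCost
  gcongr
  · exact le_rfl
  have := P.tree_sum_le (fun t h => P.regCost t ((P.regPlan O).state t h))
    (fun t h => P.f t h.last (P.regCopy O t h) ((P.regPlan O).dec t h) +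
      ENNReal.ofReal (P.σ t h.last * P.ψ t h.last ((P.regPlan O).state t h.parent -
        P.regCopy O t h))) P.T
    (fun t ht n => by
      rw [regCost_of_lt ht]
      gcongr with m
      have h1 := (hO.fwd_regVal hP ht (n.child m).last
        (hO.regState_mem hP t ht (n.child m).parent)).2.2
      rw [regPlan_state, regPlan_state]
      refine h1.le.trans ?_
      rw [TreeNode.parent_child, TreeNode.last_child, regPlan_state]) (fun s => s.elim0)
  exact le_self_add.trans this

/-- If the penalty reformulation is exact, then `vReg` is the cost of some feasible plan. -/
theorem ValidOracles.exists_primCost_eq (hO : P.ValidOracles O) (hP : P.Admissible)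
    (hexact : P.ExactPenalty) : ∃ π, P.Feasible π ∧ P.primCost π = P.vReg := by
  have hf := hO.penFeasible_regPlan hP
  have he := le_antisymm (hO.penCost_regPlan_le hP) (vReg_le_penCost hf)
  -- The plan attains the lower bound `vReg`, so it is optimal for the penalty reformulation;
  -- exactness makes its copies equal to the parent states, and all penalties vanish.
  have hz := hexact _ _ hf fun π' z' h' => he.le.trans (vReg_le_penCost h')
  refine ⟨P.regPlan O, hf.1, ?_⟩
  rw [← he]
  unfold primCost penCost
  congr 1
  refine Finset.sum_congr rfl fun t ht => Finset.sum_congr rfl fun h _ => ?_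
  rw [Finset.mem_range] at ht
  rw [hz t ht h, sub_self, hP.psi_zero ht, mul_zero, ENNReal.ofReal_zero, add_zero]

end StagewiseProblem

/-! ### Extended real sums and the convex hull of two functions -/

theorem EReal.coe_finsetSum {ι : Type*} (s : Finset ι) (g : ι → ℝ) :
    ((∑ i ∈ s, g i : ℝ) : EReal) = ∑ i ∈ s, (g i : EReal) := by
  classical
  induction s using Finset.induction with
  | empty => simp
  | insert a s ha ih => rw [Finset.sum_insert ha, Finset.sum_insert ha, EReal.coe_add, ih]

theorem convHullFun_le_min {V : Type*} [NormedAddCommGroup V] [NormedSpace ℝ V] (f g : V → EReal)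
    (x : V) : convHullFun f g x ≤ min (f x) (g x) := by
  refine iSup_le fun l => (iInf_le _ x).trans ?_
  simp

/-- A common affine minorant is a minorant of the convex hull. -/
theorem le_convHullFun {V : Type*} [NormedAddCommGroup V] [NormedSpace ℝ V] {f g : V → EReal}
    {c : ℝ} (l : V →L[ℝ] ℝ) (hf : ∀ z, ((c + l z : ℝ) : EReal) ≤ f z)
    (hg : ∀ z, ((c + l z : ℝ) : EReal) ≤ g z) (x : V) :
    ((c + l x : ℝ) : EReal) ≤ convHullFun f g x := by
  refine le_iSup_of_le l (le_iInf fun z => ?_)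
  calc ((c + l x : ℝ) : EReal) = ((c + l z : ℝ) : EReal) + ((l (x - z) : ℝ) : EReal) := by
        rw [← EReal.coe_add, map_sub]
        congr 1
        ring
    _ ≤ _ := by gcongr; exact le_min (hf z) (hg z)

namespace StagewiseProblem

variable {E : ℕ → Type u} {C : ℕ → Type v} {Yr : Type w} {Y : (t : ℕ) → C t → Type w'}
  [∀ t, NormedAddCommGroup (E t)] [∀ t, NormedSpace ℝ (E t)] [∀ t, Fintype (C t)]
  [NormedAddCommGroup Yr] [NormedSpace ℝ Yr]
  [∀ t m, NormedAddCommGroup (Y t m)] [∀ t m, NormedSpace ℝ (Y t m)]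

variable {P : StagewiseProblem E C Yr Y} {O : Oracles E C Yr Y}

/-! ### The subproblems with real values -/

theorem fwdObj_eq_coe {t : ℕ} {m : C t} {x : E t} {Θ : E (t + 1) → ℝ} {q : E (t + 1) × Y t m}
    {z : E t} (hf : P.f t m z q ≠ ⊤) : P.fwdObj t m x Θ q z =
      (((P.f t m z q).toReal + P.σ t m * P.ψ t m (x - z) + Θ q.1 : ℝ) : EReal) := by
  unfold fwdObj
  rw [← EReal.coe_ennreal_toReal hf, ← EReal.coe_add, add_assoc]

theorem fwdObj_eq_top {t : ℕ} {m : C t} {x : E t} {Θ : E (t + 1) → ℝ} {q : E (t + 1) × Y t m}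
    {z : E t} (hf : P.f t m z q = ⊤) : P.fwdObj t m x Θ q z = ⊤ := by
  unfold fwdObj
  rw [hf, EReal.coe_ennreal_top, EReal.top_add_coe]

theorem bwdObj_eq_coe {t : ℕ} {m : C t} {x : E t} {Θ : E (t + 1) → ℝ} {lam : E t →L[ℝ] ℝ} {ρ : ℝ}
    {q : E (t + 1) × Y t m} {z : E t} (hf : P.f t m z q ≠ ⊤) : P.bwdObj t m x Θ lam ρ q z =
      (((P.f t m z q).toReal + lam (x - z) + ρ * P.ψ t m (x - z) + Θ q.1 : ℝ) : EReal) := by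
  unfold bwdObj
  rw [← EReal.coe_ennreal_toReal hf, ← EReal.coe_add]
  congr 1
  ring

theorem bwdObj_eq_top {t : ℕ} {m : C t} {x : E t} {Θ : E (t + 1) → ℝ} {lam : E t →L[ℝ] ℝ} {ρ : ℝ}
    {q : E (t + 1) × Y t m} {z : E t} (hf : P.f t m z q = ⊤) :
    P.bwdObj t m x Θ lam ρ q z = ⊤ := by
  unfold bwdObj
  rw [hf, EReal.coe_ennreal_top, EReal.top_add_coe]

variable {t : ℕ} {x : E t} {Θ : E (t + 1) → ℝ}

theorem ValidOracles.fwd_spec (hO : P.ValidOracles O) (hP : P.Admissible) (ht : t < P.T) (m : C t)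
    (hx : x ∈ P.stateSpace t) (hΘ : ContinuousOn Θ (P.stateSpace (t + 1))) :
    (O.fwd t m x Θ).xy ∈ P.F t m ∧ (O.fwd t m x Θ).z ∈ P.stateSpace t ∧
      P.f t m (O.fwd t m x Θ).z (O.fwd t m x Θ).xy ≠ ⊤ ∧
      ∀ q ∈ P.F t m, ∀ z ∈ P.stateSpace t, P.f t m z q ≠ ⊤ →
        (P.f t m (O.fwd t m x Θ).z (O.fwd t m x Θ).xy).toReal +
          P.σ t m * P.ψ t m (x - (O.fwd t m x Θ).z) + Θ (O.fwd t m x Θ).xy.1 ≤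
        (P.f t m z q).toReal + P.σ t m * P.ψ t m (x - z) + Θ q.1 := by
  obtain ⟨h1, h2, h3⟩ := hO.fwd t ht m x hx Θ
    (hΘ.mono (P.nodeStateSpace_subset t m)).lowerSemicontinuousOn
  have hf : P.f t m (O.fwd t m x Θ).z (O.fwd t m x Θ).xy ≠ ⊤ := by
    intro hf
    obtain ⟨z, hz, q, hq, hf'⟩ := hP.exists_node_finite ht m
    have := h3 q hq z hz
    rw [fwdObj_eq_top hf, fwdObj_eq_coe hf', top_le_iff] at this
    exact EReal.coe_ne_top _ this
  refine ⟨h1, h2, hf, fun q hq z hz hf' => ?_⟩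
  have := h3 q hq z hz
  rwa [fwdObj_eq_coe hf, fwdObj_eq_coe hf', EReal.coe_le_coe_iff] at this

/-- The form in which the backward oracle is used: feasible multipliers, `cutVal` as a lower bound
of the inner objective, and `cutVal` at least any inner lower bound obtained from other feasible
multipliers. -/
theorem ValidOracles.bwd_spec (hO : P.ValidOracles O) (hP : P.Admissible) (ht : t < P.T) (m : C t)
    (hx : x ∈ P.stateSpace t) (hΘ : ContinuousOn Θ (P.stateSpace (t + 1))) :
    ((O.bwd t m x Θ).lam, (O.bwd t m x Θ).ρ) ∈ P.dualSet t m ∧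
      (∀ q ∈ P.F t m, ∀ z ∈ P.stateSpace t, P.f t m z q ≠ ⊤ → P.cutVal O t m x Θ ≤
        (P.f t m z q).toReal + (O.bwd t m x Θ).lam (x - z) +
          (O.bwd t m x Θ).ρ * P.ψ t m (x - z) + Θ q.1) ∧
      ∀ u ∈ P.dualSet t m, ∀ v : ℝ, (∀ q ∈ P.F t m, ∀ z ∈ P.stateSpace t, P.f t m z q ≠ ⊤ →
        v ≤ (P.f t m z q).toReal + u.1 (x - z) + u.2 * P.ψ t m (x - z) + Θ q.1) →
        v ≤ P.cutVal O t m x Θ := by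
  obtain ⟨h1, h2, h3, h4, h5⟩ := hO.bwd t ht m x hx Θ
    (hΘ.mono (P.nodeStateSpace_subset t m)).lowerSemicontinuousOn
  have hf : P.f t m (O.bwd t m x Θ).z (O.bwd t m x Θ).xy ≠ ⊤ := by
    intro hf
    obtain ⟨z, hz, q, hq, hf'⟩ := hP.exists_node_finite ht m
    have := h5 q hq z hz
    rw [bwdObj_eq_top hf, bwdObj_eq_coe hf', top_le_iff] at this
    exact EReal.coe_ne_top _ this
  refine ⟨h1, fun q hq z hz hf' => ?_, fun u hu v hv => ?_⟩
  · have := h5 q hq z hz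
    rwa [bwdObj_eq_coe hf, bwdObj_eq_coe hf', EReal.coe_le_coe_iff] at this
  · have h6 : P.dualVal t m x Θ (O.bwd t m x Θ).lam (O.bwd t m x Θ).ρ ≤ P.cutVal O t m x Θ := by
      refine ((iInf₂_le _ h3).trans (iInf₂_le _ h4)).trans_eq ?_
      rw [bwdObj_eq_coe hf]
      rfl
    have h7 : (v : EReal) ≤ P.dualVal t m x Θ u.1 u.2 := by
      refine le_iInf₂ fun q hq => le_iInf₂ fun z hz => ?_
      by_cases hf' : P.f t m z q = ⊤
      · rw [bwdObj_eq_top hf']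
        exact le_top
      · rw [bwdObj_eq_coe hf', EReal.coe_le_coe_iff]
        exact hv q hq z hz hf'
    exact EReal.coe_le_coe_iff.1 ((h7.trans (h2 u hu)).trans h6)

/-- The optimal value of the backward subproblem is at least that of the forward subproblem. -/
theorem ValidOracles.le_cutVal (hO : P.ValidOracles O) (hP : P.Admissible) (hdual : P.DualBounds)
    (ht : t < P.T) (m : C t)
    (hx : x ∈ P.stateSpace t) (hΘ : ContinuousOn Θ (P.stateSpace (t + 1)))
    (hΘc : (∀ t < P.T, ∀ m, P.lRho t m = 0) → ConvexOn ℝ Set.univ Θ) {v : ℝ}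
    (hv : ∀ q ∈ P.F t m, ∀ z ∈ P.stateSpace t, P.f t m z q ≠ ⊤ →
      v ≤ (P.f t m z q).toReal + P.σ t m * P.ψ t m (x - z) + Θ q.1) :
    v ≤ P.cutVal O t m x Θ := by
  obtain ⟨-, -, h⟩ := hO.bwd_spec hP ht m hx hΘ
  have hσ := (hP.σ_pos t ht m).le
  rcases hdual with ⟨hc, hd⟩ | hd
  · have hΘ' := hΘc fun t ht m => (hd t ht m).2.2
    obtain ⟨hψ, hσl, hρ⟩ := hd t ht m
    -- `K` consists of the points above the projected function `z ↦ inf_q (f + Θ)`. It is convex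
    -- because the cost is jointly convex and `Θ` is convex, and `hv` says that it avoids the cone
    -- of slope `σ` below `v`.
    obtain ⟨l, hl, hl'⟩ := exists_linear_minorant (σ := P.σ t m) (x := x) (v := v)
      (K := {k : E t × ℝ | k.1 ∈ P.stateSpace t ∧ ∃ q ∈ P.F t m, P.f t m k.1 q ≠ ⊤ ∧
        (P.f t m k.1 q).toReal + Θ q.1 ≤ k.2}) (by
        rintro ⟨z₁, s₁⟩ ⟨hz₁, q₁, hq₁, hf₁, hs₁⟩ ⟨z₂, s₂⟩ ⟨hz₂, q₂, hq₂, hf₂, hs₂⟩ a b ha hb hab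
        obtain ⟨hf, hle⟩ := hc.f_le ht hz₁ hz₂ hq₁ hq₂ hf₁ hf₂ ha hb hab
        refine ⟨hc.convex_stateSpace hP ht hz₁ hz₂ ha hb hab, a • q₁ + b • q₂,
          hc.convex_node hP ht m hq₁ hq₂ ha hb hab, hf, ?_⟩
        have h1 := hΘ'.2 (Set.mem_univ q₁.1) (Set.mem_univ q₂.1) ha hb hab
        have h2 := mul_le_mul_of_nonneg_left hs₁ ha
        have h3 := mul_le_mul_of_nonneg_left hs₂ hb
        simp only [smul_eq_mul, Prod.fst_add, Prod.smul_fst, Prod.smul_mk, Prod.mk_add_mk] at *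
        linarith) hσ (by
        rintro ⟨z, s⟩ ⟨hz, q, hq, hf, hs⟩
        have := hv q hq z hz hf
        rw [hψ] at this
        simp only at hs ⊢
        linarith)
    refine h (l, 0) ⟨hl.trans hσl, le_rfl, hρ.ge⟩ v fun q hq z hz hf => ?_
    have := hl' (z, (P.f t m z q).toReal + Θ q.1) ⟨hz, q, hq, hf, le_rfl⟩
    simp only at this ⊢
    linarith
  -- With `λ = 0` and `ρ = σ` the inner problem is the forward problem itself.
  · refine h (0, P.σ t m) ⟨by simpa using hP.lLam_nonneg t ht m, hσ, hd t ht m⟩ v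
      fun q hq z hz hf => ?_
    have := hv q hq z hz hf
    simpa using this

/-! ### Cuts -/

/-- With the copy `z = y` the multiplier terms of the inner objective are exactly those subtracted
in the cut. The bound concerns the cost without penalty, for any size of the multipliers. -/
theorem ValidOracles.cut_le (hO : P.ValidOracles O) (hP : P.Admissible)
    (ht : t < P.T) (m : C t) (hx : x ∈ P.stateSpace t)
    (hΘ : ContinuousOn Θ (P.stateSpace (t + 1))) {y : E t} (hy : y ∈ P.stateSpace t)
    {q : E (t + 1) × Y t m} (hq : q ∈ P.F t m) (hf : P.f t m y q ≠ ⊤) :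
    P.cut O t m x Θ y ≤ (P.f t m y q).toReal + Θ q.1 := by
  have := (hO.bwd_spec hP ht m hx hΘ).2.1 q hq y hy hf
  simp only [cut]
  linarith

theorem ValidOracles.le_cut (hO : P.ValidOracles O) (hP : P.Admissible)
    (ht : t < P.T) (m : C t) (hx : x ∈ P.stateSpace t)
    (hΘ : ContinuousOn Θ (P.stateSpace (t + 1))) {y : E t} (hy : y ∈ P.stateSpace t) :
    P.cutVal O t m x Θ - (P.lLam t m + P.lRho t m) * ‖y - x‖ ≤ P.cut O t m x Θ y := by
  obtain ⟨h1, h2, h3⟩ := (hO.bwd_spec hP ht m hx hΘ).1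
  simp only at h1 h2 h3
  have h4 : (O.bwd t m x Θ).lam (x - y) ≤ P.lLam t m * ‖y - x‖ := by
    rw [norm_sub_rev y x]
    exact (le_abs_self _).trans (((O.bwd t m x Θ).lam.le_opNorm (x - y)).trans (by gcongr))
  have h5 : (O.bwd t m x Θ).ρ * P.ψ t m (x - y) ≤ P.lRho t m * ‖y - x‖ := by
    rw [norm_sub_rev y x]
    exact mul_le_mul h3 (hP.psi_le_norm ht m hx hy) ((hP.penalty t ht m).nonneg _) (h2.trans h3)
  simp only [cut]
  linarith

theorem Admissible.continuousOn_cut (hP : P.Admissible) (ht : t < P.T) (m : C t)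
    (hx : x ∈ P.stateSpace t) : ContinuousOn (P.cut O t m x Θ) (P.stateSpace t) := by
  have h1 : ContinuousOn (fun y => P.ψ t m (x - y)) (P.stateSpace t) :=
    (hP.penalty_lip t ht m).continuousOn.comp (continuousOn_const.sub continuousOn_id)
      fun y hy => ⟨x, hx, y, hy, rfl⟩
  have h2 : Continuous fun y => P.cutVal O t m x Θ - (O.bwd t m x Θ).lam (x - y) := by fun_prop
  exact h2.continuousOn.sub (h1.const_mul _)

theorem ValidOracles.convexOn_cut (hO : P.ValidOracles O) (hP : P.Admissible)
    (ht : t < P.T) (m : C t) (hx : x ∈ P.stateSpace t)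
    (hΘ : ContinuousOn Θ (P.stateSpace (t + 1))) (hρ : P.lRho t m = 0) :
    ConvexOn ℝ Set.univ (P.cut O t m x Θ) := by
  obtain ⟨-, h2, h3⟩ := (hO.bwd_spec hP ht m hx hΘ).1
  have h4 : (O.bwd t m x Θ).ρ = 0 := le_antisymm (h3.trans_eq hρ) h2
  have h5 : P.cut O t m x Θ = fun y => (O.bwd t m x Θ).lam y +
      (P.cutVal O t m x Θ - (O.bwd t m x Θ).lam x) := by
    funext y
    simp only [cut, h4, map_sub]
    ring
  rw [h5]
  exact ((O.bwd t m x Θ).lam.toLinearMap.convexOn convex_univ).add (convexOn_const _ convex_univ)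

/-! ### Invariants of the algorithm -/

/-- The properties of the variables of the algorithm which hold after every iteration. -/
structure Invariant (P : StagewiseProblem E C Yr Y) (s : AlgState E Yr) : Prop where
  lo_nonneg : ∀ t x, 0 ≤ s.lo t x
  lo_last : ∀ x, s.lo P.T x = 0
  lo_cont : ∀ t ≤ P.T, ContinuousOn (s.lo t) (P.stateSpace t)
  -- The substitute for `lo ≤ regVal`, which may fail: a Bellman inequality for the unpenalized
  -- problem, preserved because `lo (t + 1)` only increases.
  lo_sub : ∀ t < P.T, ∀ x ∈ P.stateSpace t, ∀ q : (m : C t) → E (t + 1) × Y t m,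
    (∀ m, q m ∈ P.F t m) → (∀ m, P.f t m x (q m) ≠ ⊤) →
    s.lo t x ≤ ∑ m, (P.p t m : ℝ) * ((P.f t m x (q m)).toReal + s.lo (t + 1) (q m).1)
  lo_convex : (∀ t < P.T, ∀ m, P.lRho t m = 0) → ∀ t ≤ P.T, ConvexOn ℝ Set.univ (s.lo t)
  hi_last : ∀ x, s.hi P.T x = 0
  hi_ge : ∀ t ≤ P.T, ∀ x ∈ P.stateSpace t, (P.regVal t x : EReal) ≤ s.hi t x
  -- Stronger than `hi_ge`: whole affine minorants are kept, at all `z` of the space, since the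
  -- biconjugate also sees points outside the state space.
  hi_convex : P.IsConvex → ∀ t < P.T, ∀ x ∈ P.stateSpace t, ∀ l : C t → E t →L[ℝ] ℝ,
    (∀ m, P.IsNodeSubgradient t m x (l m)) → ∀ z,
      ((∑ m, (P.p t m : ℝ) * (P.nodeVal t m x + l m (z - x)) : ℝ) : EReal) ≤ s.hi t z
  cur_mem : s.cur ∈ P.Fr
  cur_min : ∀ q ∈ P.Fr, (P.fr s.cur : EReal) + (s.lo 0 s.cur.1 : EReal) ≤
    (P.fr q : EReal) + (s.lo 0 q.1 : EReal)
  lb_eq : s.lb = (P.fr s.cur : EReal) + (s.lo 0 s.cur.1 : EReal)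
  ub_le : s.ub ≤ (P.fr s.cur : EReal) + s.hi 0 s.cur.1
  best : s.ub = ⊤ ∨ ∃ q ∈ P.Fr, s.best = some q ∧
    (P.fr q : EReal) + (P.regVal 0 q.1 : EReal) ≤ s.ub

theorem ValidOracles.invariant_algInit (hO : P.ValidOracles O) (hT : 1 ≤ P.T) :
    P.Invariant (P.algInit O) where
  lo_nonneg _ _ := le_rfl
  lo_last _ := rfl
  lo_cont _ _ := continuousOn_const
  lo_sub t ht x hx q hq hf := by
    refine Finset.sum_nonneg fun m _ => mul_nonneg (P.p t m).2 ?_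
    exact add_nonneg ENNReal.toReal_nonneg le_rfl
  lo_convex _ _ _ := convexOn_const _ convex_univ
  hi_last x := by simp [algInit]
  hi_ge t ht x _ := by
    rcases ht.eq_or_lt with rfl | ht
    · simp [algInit, regVal_last]
    · simp [algInit, ht]
  hi_convex _ t ht x _ l _ z := by simp [algInit, ht]
  cur_mem := (hO.root _ continuousOn_const.lowerSemicontinuousOn).1
  cur_min := (hO.root _ continuousOn_const.lowerSemicontinuousOn).2
  lb_eq := by simp [algInit]
  ub_le := by
    have : 0 < P.T := hT
    simp only [algInit, this, if_true]
    rw [EReal.add_top_of_ne_bot]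
    exact EReal.coe_ennreal_ne_bot _
  best := Or.inl rfl

/-! ### One iteration -/

section Step

variable {i : ℕ} {s : AlgState E Yr}

theorem newUnder_last (x : E P.T) : (P.algStep O i s).lo P.T x = 0 := by
  change P.newUnderAux O i s (P.T - P.T) P.T x = 0
  rw [Nat.sub_self]
  rfl

theorem newUnder_of_lt (ht : t < P.T) (x : E t) : (P.algStep O i s).lo t x =
    max (s.lo t x) (∑ m, (P.p t m : ℝ) *
      P.cut O t m (fwdState O i s t) ((P.algStep O i s).lo (t + 1)) x) := by
  change P.newUnderAux O i s (P.T - t) t x = max _ (∑ m, (P.p t m : ℝ) *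
    P.cut O t m (fwdState O i s t) (P.newUnderAux O i s (P.T - (t + 1)) (t + 1)) x)
  have : P.T - t = P.T - (t + 1) + 1 := by omega
  rw [this]
  rfl

/-- The forward solution at the node `m` of stage `t + 1`. -/
def fwdSol (O : Oracles E C Yr Y) (i : ℕ) (s : AlgState E Yr) (t : ℕ) (m : C t) :
    FwdSol (E (t + 1)) (E t) (Y t m) :=
  O.fwd t m (fwdState O i s t) (s.lo (t + 1))

/-- The upper bound for the value of the node `m` of stage `t + 1` in the backward step. -/
def overVal (P : StagewiseProblem E C Yr Y) (O : Oracles E C Yr Y) (i : ℕ) (s : AlgState E Yr)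
    (t : ℕ) (m : C t) : EReal :=
  (P.f t m (fwdSol O i s t m).z (fwdSol O i s t m).xy : EReal) +
    ((P.σ t m * P.ψ t m (fwdState O i s t - (fwdSol O i s t m).z) : ℝ) : EReal) +
    (P.algStep O i s).hi (t + 1) (fwdSol O i s t m).xy.1

/-- The cone by which the over-approximation of stage `t` is updated. -/
def overCone (P : StagewiseProblem E C Yr Y) (O : Oracles E C Yr Y) (i : ℕ) (s : AlgState E Yr)
    (t : ℕ) (x : E t) : EReal :=
  ∑ m, ((P.p t m : ℝ) : EReal) *
    (P.overVal O i s t m + ((P.σ t m * ‖x - fwdState O i s t‖ : ℝ) : EReal))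

theorem newOver_last (x : E P.T) : (P.algStep O i s).hi P.T x = 0 := by
  change P.newOverAux O i s (P.T - P.T) P.T x = 0
  rw [Nat.sub_self]
  rfl

open Classical in
theorem newOver_of_lt (ht : t < P.T) : (P.algStep O i s).hi t =
    if P.IsConvex then convHullFun (s.hi t) (P.overCone O i s t)
    else fun x => min (s.hi t x) (P.overCone O i s t x) := by
  change P.newOverAux O i s (P.T - t) t = _
  have : P.T - t = P.T - (t + 1) + 1 := by omega
  rw [this]
  rfl

theorem newOver_le_min (ht : t < P.T) (x : E t) :
    (P.algStep O i s).hi t x ≤ min (s.hi t x) (P.overCone O i s t x) := by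
  rw [newOver_of_lt ht]
  split_ifs
  · exact convHullFun_le_min _ _ _
  · exact le_rfl

variable (hO : P.ValidOracles O) (hP : P.Admissible) (hs : P.Invariant s)

include hO hP hs

theorem fwdState_mem : ∀ t < P.T, fwdState O i s t ∈ P.stateSpace t
  | 0, _ => ⟨s.cur, hs.cur_mem, rfl⟩
  | t + 1, ht => fst_mem_stateSpace (hO.fwd_spec hP (t.lt_succ_self.trans ht) _
      (fwdState_mem t (t.lt_succ_self.trans ht)) (hs.lo_cont _ ht.le)).1

theorem fwdSol_spec (ht : t < P.T) (m : C t) : (fwdSol O i s t m).xy ∈ P.F t m ∧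
    (fwdSol O i s t m).z ∈ P.stateSpace t ∧
    P.f t m (fwdSol O i s t m).z (fwdSol O i s t m).xy ≠ ⊤ ∧
    ∀ q ∈ P.F t m, ∀ z ∈ P.stateSpace t, P.f t m z q ≠ ⊤ →
      (P.f t m (fwdSol O i s t m).z (fwdSol O i s t m).xy).toReal +
        P.σ t m * P.ψ t m (fwdState O i s t - (fwdSol O i s t m).z) +
          s.lo (t + 1) (fwdSol O i s t m).xy.1 ≤
      (P.f t m z q).toReal + P.σ t m * P.ψ t m (fwdState O i s t - z) + s.lo (t + 1) q.1 :=
  hO.fwd_spec hP ht m (fwdState_mem hO hP hs t ht) (hs.lo_cont _ ht)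

theorem newUnder_cont (ht : t ≤ P.T) :
    ContinuousOn ((P.algStep O i s).lo t) (P.stateSpace t) := by
  rcases ht.eq_or_lt with rfl | ht
  · exact continuousOn_const.congr fun x _ => newUnder_last x
  · refine ContinuousOn.congr ?_ fun x _ => newUnder_of_lt ht x
    exact (hs.lo_cont t ht.le).sup (continuousOn_finsetSum _ fun m _ =>
      (hP.continuousOn_cut ht m (fwdState_mem hO hP hs t ht)).const_mul _)

omit hO hP in
theorem le_newUnder (ht : t ≤ P.T) (x : E t) : s.lo t x ≤ (P.algStep O i s).lo t x := by
  rcases ht.eq_or_lt with rfl | ht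
  · rw [newUnder_last, hs.lo_last]
  · rw [newUnder_of_lt ht]
    exact le_max_left _ _

theorem newUnder_convex (hρ : ∀ t < P.T, ∀ m, P.lRho t m = 0) (ht : t ≤ P.T) :
    ConvexOn ℝ Set.univ ((P.algStep O i s).lo t) := by
  rcases ht.eq_or_lt with rfl | ht
  · exact (convexOn_const 0 convex_univ).congr fun x _ => (newUnder_last x).symm
  · have h1 : ConvexOn ℝ Set.univ fun x => ∑ m, (P.p t m : ℝ) *
        P.cut O t m (fwdState O i s t) ((P.algStep O i s).lo (t + 1)) x := by
      have h2 : ∀ m, ConvexOn ℝ Set.univ fun x => (P.p t m : ℝ) *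
          P.cut O t m (fwdState O i s t) ((P.algStep O i s).lo (t + 1)) x := fun m =>
        (hO.convexOn_cut hP ht m (fwdState_mem hO hP hs t ht) (newUnder_cont hO hP hs ht)
          (hρ t ht m)).smul (P.p t m).2
      refine ⟨convex_univ, fun x hx y hy a b ha hb hab => ?_⟩
      rw [smul_eq_mul, smul_eq_mul, Finset.mul_sum, Finset.mul_sum, ← Finset.sum_add_distrib]
      exact Finset.sum_le_sum fun m _ => (h2 m).2 hx hy ha hb hab
    exact ((hs.lo_convex hρ t ht.le).sup h1).congr fun x _ => (newUnder_of_lt ht x).symm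

theorem newUnder_sub (ht : t < P.T) (hx : x ∈ P.stateSpace t)
    (q : (m : C t) → E (t + 1) × Y t m) (hq : ∀ m, q m ∈ P.F t m)
    (hf : ∀ m, P.f t m x (q m) ≠ ⊤) :
    (P.algStep O i s).lo t x ≤
      ∑ m, (P.p t m : ℝ) * ((P.f t m x (q m)).toReal + (P.algStep O i s).lo (t + 1) (q m).1) := by
  rw [newUnder_of_lt ht]
  refine max_le ((hs.lo_sub t ht x hx q hq hf).trans ?_) ?_
  · gcongr with m
    exact le_newUnder hs ht _
  · gcongr with m
    exact hO.cut_le hP ht m (fwdState_mem hO hP hs t ht) (newUnder_cont hO hP hs ht) hx (hq m)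
      (hf m)

omit hO hP in
theorem newOver_le (ht : t ≤ P.T) (x : E t) : (P.algStep O i s).hi t x ≤ s.hi t x := by
  rcases ht.eq_or_lt with rfl | ht
  · rw [newOver_last, hs.hi_last]
  · exact (newOver_le_min ht x).trans (min_le_left _ _)

theorem nodeVal_le_overVal (ht : t < P.T)
    (h : ∀ x ∈ P.stateSpace (t + 1), (P.regVal (t + 1) x : EReal) ≤
      (P.algStep O i s).hi (t + 1) x) (m : C t) :
    (P.nodeVal t m (fwdState O i s t) : EReal) ≤ P.overVal O i s t m := by
  obtain ⟨hq, hz, hf, -⟩ := fwdSol_spec (i := i) hO hP hs ht m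
  refine (EReal.coe_le_coe_iff.2 (hP.nodeVal_le ht hq hz hf _)).trans ?_
  unfold overVal
  rw [← EReal.coe_ennreal_toReal hf, EReal.coe_add, EReal.coe_add]
  gcongr
  exact h _ (fst_mem_stateSpace hq)

omit hO hP hs in
theorem le_overCone {a : C t → ℝ} (ha : ∀ m, (a m : EReal) ≤ P.overVal O i s t m) (x : E t) :
    ((∑ m, (P.p t m : ℝ) * (a m + P.σ t m * ‖x - fwdState O i s t‖) : ℝ) : EReal) ≤
      P.overCone O i s t x := by
  rw [EReal.coe_finsetSum]
  refine Finset.sum_le_sum fun m _ => ?_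
  rw [EReal.coe_mul (P.p t m : ℝ), EReal.coe_add (a m)]
  gcongr
  exact ha m

omit hO hP hs in
theorem overCone_le {a : C t → ℝ} (ha : ∀ m, P.overVal O i s t m ≤ (a m : EReal)) (x : E t) :
    P.overCone O i s t x ≤
      ((∑ m, (P.p t m : ℝ) * (a m + P.σ t m * ‖x - fwdState O i s t‖) : ℝ) : EReal) := by
  rw [EReal.coe_finsetSum]
  refine Finset.sum_le_sum fun m _ => ?_
  rw [EReal.coe_mul (P.p t m : ℝ), EReal.coe_add (a m)]
  gcongr
  exact ha m

/-- A common affine minorant of the old `hi` and of the new cone is one of their convex hull. At the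
apex the averaged subgradients stay below the cone by the subgradient inequality, and elsewhere
because their norms are at most `σ`. -/
theorem newOver_convex_of_succ (hc : P.IsConvex) (ht : t < P.T)
    (h : ∀ x ∈ P.stateSpace (t + 1), (P.regVal (t + 1) x : EReal) ≤
      (P.algStep O i s).hi (t + 1) x) (hx : x ∈ P.stateSpace t) (l : C t → E t →L[ℝ] ℝ)
    (hl : ∀ m, P.IsNodeSubgradient t m x (l m)) (z : E t) :
    ((∑ m, (P.p t m : ℝ) * (P.nodeVal t m x + l m (z - x)) : ℝ) : EReal) ≤
      (P.algStep O i s).hi t z := by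
  rw [newOver_of_lt ht, if_pos hc]
  have e : ∀ z, ∑ m, (P.p t m : ℝ) * (P.nodeVal t m x + l m (z - x)) =
      ∑ m, (P.p t m : ℝ) * (P.nodeVal t m x - l m x) + (∑ m, (P.p t m : ℝ) • l m) z := by
    intro z
    rw [sum_apply, ← Finset.sum_add_distrib]
    refine Finset.sum_congr rfl fun m _ => ?_
    rw [smul_apply, smul_eq_mul, map_sub]
    ring
  rw [e]
  refine le_convHullFun _ (fun z => ?_) (fun z => ?_) z
  · rw [← e]
    exact hs.hi_convex hc t ht x hx l hl z
  · rw [← e]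
    refine le_trans ?_ (le_overCone (nodeVal_le_overVal hO hP hs ht h) z)
    rw [EReal.coe_le_coe_iff]
    refine Finset.sum_le_sum fun m _ => mul_le_mul_of_nonneg_left ?_ (P.p t m).2
    have h1 := (hl m).2 _ (fwdState_mem (i := i) hO hP hs t ht)
    have h2 : l m (z - fwdState O i s t) ≤ P.σ t m * ‖z - fwdState O i s t‖ :=
      (le_abs_self _).trans (((l m).le_opNorm _).trans
        (mul_le_mul_of_nonneg_right (hl m).1 (norm_nonneg _)))
    rw [map_sub] at *
    linarith

theorem newOver_ge (ht : t ≤ P.T) :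
    ∀ x ∈ P.stateSpace t, (P.regVal t x : EReal) ≤ (P.algStep O i s).hi t x := by
  induction ht using Nat.decreasingInduction with
  | self => intro x _; rw [newOver_last, regVal_last, EReal.coe_zero]
  | of_succ t ht ih =>
    intro x hx
    by_cases hc : P.IsConvex
    · choose l hl using fun m => hO.exists_nodeSubgradient hP hc ht m hx
      have := newOver_convex_of_succ hO hP hs hc ht ih hx l hl x
      simpa only [sub_self, map_zero, add_zero, ← hP.regVal_of_lt ht] using this
    · rw [newOver_of_lt ht, if_neg hc]
      refine le_min (hs.hi_ge t ht.le x hx) ?_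
      refine le_trans ?_ (le_overCone (nodeVal_le_overVal hO hP hs ht ih) x)
      rw [EReal.coe_le_coe_iff, hP.regVal_of_lt ht]
      gcongr with m
      exact hP.nodeVal_le_add ht m hx (fwdState_mem hO hP hs t ht)

theorem invariant_algStep : P.Invariant (P.algStep O i s) where
  lo_nonneg t x := by
    rcases lt_or_ge t P.T with ht | ht
    · exact (hs.lo_nonneg t x).trans (le_newUnder hs ht.le x)
    · change 0 ≤ P.newUnderAux O i s (P.T - t) t x
      rw [Nat.sub_eq_zero_of_le ht]
      exact le_rfl
  lo_last := newUnder_last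
  lo_cont _ ht := newUnder_cont hO hP hs ht
  lo_sub _ ht _ hx q hq hf := newUnder_sub hO hP hs ht hx q hq hf
  lo_convex hρ _ ht := newUnder_convex hO hP hs hρ ht
  hi_last := newOver_last
  hi_ge _ ht := newOver_ge hO hP hs ht
  hi_convex hc _ ht _ hx l hl z :=
    newOver_convex_of_succ hO hP hs hc ht (newOver_ge hO hP hs ht) hx l hl z
  cur_mem := (hO.root _ (newUnder_cont hO hP hs (Nat.zero_le _)).lowerSemicontinuousOn).1
  cur_min := (hO.root _ (newUnder_cont hO hP hs (Nat.zero_le _)).lowerSemicontinuousOn).2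
  lb_eq := rfl
  ub_le := by
    change (if _ then _ else _) ≤ _
    split_ifs with h
    · exact le_rfl
    · exact not_lt.1 h
  best := by
    have hcur := (hO.root _ (newUnder_cont (i := i) hO hP hs
      (Nat.zero_le _)).lowerSemicontinuousOn).1
    by_cases h : (P.fr (P.algStep O i s).cur : EReal) + (P.algStep O i s).hi 0
        (P.algStep O i s).cur.1 < s.ub
    · refine Or.inr ⟨_, hcur, if_pos h, ?_⟩
      have hub : (P.algStep O i s).ub = (P.fr (P.algStep O i s).cur : EReal) +
        (P.algStep O i s).hi 0 (P.algStep O i s).cur.1 := if_pos h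
      rw [hub]
      exact add_le_add le_rfl (newOver_ge hO hP hs (Nat.zero_le _) _ ⟨_, hcur, rfl⟩)
    · have hub : (P.algStep O i s).ub = s.ub := if_neg h
      have hbest : (P.algStep O i s).best = s.best := if_neg h
      rw [hub, hbest]
      exact hs.best

/-- The gap of the approximations after an iteration, in terms of the gap at the next stage. -/
theorem newOver_le_newUnder_add (hdual : P.DualBounds) (ht : t < P.T) {c : ℝ}
    (h : ∀ m, s.hi (t + 1) (fwdSol O i s t m).xy.1 ≤
      ((s.lo (t + 1) (fwdSol O i s t m).xy.1 + c : ℝ) : EReal)) (hx : x ∈ P.stateSpace t) :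
    (P.algStep O i s).hi t x ≤ (((P.algStep O i s).lo t x +
      (c + 2 * P.lipConst t * ‖x - fwdState O i s t‖) : ℝ) : EReal) := by
  -- The optimal values of the forward problems with the old `lo`. Up to `c` they bound `overVal`
  -- from above, and they bound the new `cutVal` from below.
  set v : C t → ℝ := fun m => (P.f t m (fwdSol O i s t m).z (fwdSol O i s t m).xy).toReal +
    P.σ t m * P.ψ t m (fwdState O i s t - (fwdSol O i s t m).z) +
      s.lo (t + 1) (fwdSol O i s t m).xy.1 with hv
  have h1 : ∀ m, P.overVal O i s t m ≤ ((v m + c : ℝ) : EReal) := by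
    intro m
    have hf := (fwdSol_spec (i := i) hO hP hs ht m).2.2.1
    rw [hv, add_assoc, EReal.coe_add, EReal.coe_add]
    unfold overVal
    rw [← EReal.coe_ennreal_toReal hf]
    gcongr
    exact (newOver_le hs ht _).trans (h m)
  refine ((newOver_le_min ht x).trans (min_le_right _ _)).trans ((overCone_le h1 x).trans ?_)
  rw [EReal.coe_le_coe_iff]
  have h2 : ∑ m, (P.p t m : ℝ) *
      (v m - (P.lLam t m + P.lRho t m) * ‖x - fwdState O i s t‖) ≤ (P.algStep O i s).lo t x := by
    rw [newUnder_of_lt ht]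
    refine le_trans ?_ (le_max_right _ _)
    gcongr with m
    have hmem := fwdState_mem (i := i) hO hP hs t ht
    refine le_trans ?_ (hO.le_cut hP ht m hmem (newUnder_cont hO hP hs ht) hx)
    gcongr
    -- The backward problem uses the updated `lo (t + 1)`, which only raises the objective above the
    -- forward one.
    refine hO.le_cutVal hP hdual ht m hmem (newUnder_cont hO hP hs ht)
      (fun hρ => newUnder_convex hO hP hs hρ ht) fun q hq z hz hf => ?_
    refine ((fwdSol_spec (i := i) hO hP hs ht m).2.2.2 q hq z hz hf).trans ?_
    gcongr
    exact le_newUnder hs ht _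
  refine le_trans ?_ (add_le_add_left h2 _)
  unfold lipConst
  rw [← add_assoc, ← hP.sum_p_mul_add ht, Finset.mul_sum, Finset.sum_mul,
    ← Finset.sum_add_distrib]
  refine Finset.sum_le_sum fun m _ => ?_
  -- The cone rises with slope `σ` and the cut falls with slope at most `lLam + lRho`; this
  -- inequality merges both into the factor `2` in front of `lipConst`.
  have h3 : P.σ t m ≤ P.lLam t m + P.lRho t m := by
    have h4 := hP.lLam_nonneg t ht m
    have h5 := hP.lRho_nonneg t ht m
    rcases hdual with ⟨-, hd⟩ | hd
    · have := (hd t ht m).2.1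
      linarith
    · have := hd t ht m
      linarith
  have h6 := mul_le_mul_of_nonneg_left (mul_le_mul_of_nonneg_right h3
    (norm_nonneg (x - fwdState O i s t))) (P.p t m).2
  simp only [NNReal.val_eq_coe] at h6
  linarith

/-- The selected node has the largest gap, so a gap bound at its state covers all children. -/
theorem newOver_le_newUnder_add_of_fwdState (hdual : P.DualBounds) (ht : t < P.T) {c : ℝ}
    (h : s.hi (t + 1) (fwdState O i s (t + 1)) ≤
      ((s.lo (t + 1) (fwdState O i s (t + 1)) + c : ℝ) : EReal)) (hx : x ∈ P.stateSpace t) :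
    (P.algStep O i s).hi t x ≤ (((P.algStep O i s).lo t x +
      (c + 2 * P.lipConst t * ‖x - fwdState O i s t‖) : ℝ) : EReal) := by
  refine newOver_le_newUnder_add hO hP hs hdual ht (fun m => ?_) hx
  have h1 := hO.sel i t ht (fun m => s.hi (t + 1) (fwdSol O i s t m).xy.1 -
    (s.lo (t + 1) (fwdSol O i s t m).xy.1 : EReal)) m
  rw [add_comm (s.lo _ _) c, EReal.coe_add] at h ⊢
  have h2 := h1.trans (EReal.sub_le_of_le_add h)
  exact (EReal.sub_le_iff_le_add (.inl (EReal.coe_ne_bot _)) (.inl (EReal.coe_ne_top _))).1 h2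

end Step

end StagewiseProblem

/-! ### Validity of the bounds and of the incumbent -/

namespace StagewiseProblem

variable {E : ℕ → Type u} {C : ℕ → Type v} {Yr : Type w} {Y : (t : ℕ) → C t → Type w'}
  [∀ t, NormedAddCommGroup (E t)] [∀ t, NormedSpace ℝ (E t)] [∀ t, Fintype (C t)]
  [NormedAddCommGroup Yr] [NormedSpace ℝ Yr]
  [∀ t m, NormedAddCommGroup (Y t m)] [∀ t m, NormedSpace ℝ (Y t m)]

variable {P : StagewiseProblem E C Yr Y} {O : Oracles E C Yr Y}

theorem Admissible.isBounded_stateSpace (hP : P.Admissible) :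
    ∀ t < P.T, Bornology.IsBounded (P.stateSpace t)
  | 0, _ => (hP.compact_root.image continuous_fst).isBounded
  | t + 1, ht => Bornology.isBounded_iUnion.2 fun m =>
      ((hP.compact_node t (t.lt_succ_self.trans ht) m).image continuous_fst).isBounded

theorem Admissible.lipConst_pos (hP : P.Admissible) (hdual : P.DualBounds) {t : ℕ}
    (ht : t < P.T) : 0 < P.lipConst t := by
  have := hP.nonempty_children ht
  refine Finset.sum_pos (fun m _ => mul_pos (hP.p_pos t ht m) ?_) Finset.univ_nonempty
  have h1 := hP.σ_pos t ht m
  have h2 := hP.lLam_nonneg t ht m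
  have h3 := hP.lRho_nonneg t ht m
  rcases hdual with ⟨-, hd⟩ | hd
  · have := (hd t ht m).2.1
    linarith
  · have := hd t ht m
    linarith

/-- The under-approximation at the root is a lower bound for the cost of feasible plans. -/
theorem Invariant.lo_root_le_primCost {s : AlgState E Yr} (hs : P.Invariant s) (hP : P.Admissible)
    {π : TreePlan E C Yr Y} (hπ : P.Feasible π) :
    P.fr π.root + ENNReal.ofReal (s.lo 0 π.root.1) ≤ P.primCost π := by
  unfold primCost
  gcongr
  have := P.le_tree_sum (fun t h => ENNReal.ofReal (s.lo t (π.state t h)))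
    (fun t h => P.f t h.last (π.state t h.parent) (π.dec t h)) P.T
    (fun t ht n => by
      have hx := hπ.state_mem t ht n
      have hd : ∀ m, π.dec t (n.child m) ∈ P.F t (n.child m).last := fun m => hπ.2 t ht _
      have key : ∀ m, ∃ q ∈ P.F t m, P.f t (n.child m).last (π.state t (n.child m).parent)
          (π.dec t (n.child m)) = P.f t m (π.state t n) q ∧
          π.state (t + 1) (n.child m) = q.1 := by
        intro m
        have h1 : ∀ m', m' = m → ∀ q' : E (t + 1) × Y t m', q' ∈ P.F t m' → ∃ q ∈ P.F t m,
            P.f t m' (π.state t n) q' = P.f t m (π.state t n) q ∧ q'.1 = q.1 := by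
          rintro m' rfl q' hq'
          exact ⟨q', hq', rfl, rfl⟩
        rw [TreeNode.parent_child]
        exact h1 _ (TreeNode.last_child n m) _ (hd m)
      choose q hq hqf hq1 using key
      simp only [hqf, hq1]
      by_cases hf : ∀ m, P.f t m (π.state t n) (q m) ≠ ⊤
      -- If instead some child has infinite cost, the right-hand side is infinite because its
      -- probability is positive.
      · refine (ENNReal.ofReal_le_ofReal (hs.lo_sub t ht _ hx q hq hf)).trans_eq ?_
        have hnn : ∀ m ∈ Finset.univ, 0 ≤ (P.p t m : ℝ) *
            ((P.f t m (π.state t n) (q m)).toReal + s.lo (t + 1) (q m).1) := fun m _ =>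
          mul_nonneg (P.p t m).2 (add_nonneg ENNReal.toReal_nonneg (hs.lo_nonneg _ _))
        rw [ENNReal.ofReal_sum_of_nonneg hnn]
        refine Finset.sum_congr rfl fun m _ => ?_
        rw [ENNReal.ofReal_mul (P.p t m).coe_nonneg, ENNReal.ofReal_add ENNReal.toReal_nonneg
          (hs.lo_nonneg _ _), ENNReal.ofReal_toReal (hf m), ENNReal.ofReal_coe_nnreal]
      · push Not at hf
        obtain ⟨m, hm⟩ := hf
        have h0 : (P.p t m : ℝ≥0∞) ≠ 0 := by simpa using (hP.p_pos t ht m).ne'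
        refine le_top.trans_eq (Eq.symm ?_)
        rw [ENNReal.sum_eq_top]
        exact ⟨m, Finset.mem_univ _, by rw [hm, top_add, ENNReal.mul_top h0]⟩)
    (fun s => s.elim0)
  simp only [hs.lo_last, ENNReal.ofReal_zero, mul_zero, Finset.sum_const_zero, add_zero] at this
  exact this

theorem ValidOracles.invariant_algRun (hO : P.ValidOracles O) (hP : P.Admissible) (hT : 1 ≤ P.T) :
    ∀ i, P.Invariant (P.algRun O i)
  | 0 => hO.invariant_algInit hT
  | i + 1 => invariant_algStep hO hP (hO.invariant_algRun hP hT i)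

/-- The lower bound is a lower bound for the regularized optimal value. -/
theorem Invariant.lb_le_vReg {s : AlgState E Yr} (hs : P.Invariant s) (hO : P.ValidOracles O)
    (hP : P.Admissible) (hexact : P.ExactPenalty) : s.lb ≤ (P.vReg : EReal) := by
  obtain ⟨π, hπ, hcost⟩ := hO.exists_primCost_eq hP hexact
  rw [hs.lb_eq, ← hcost]
  refine (hs.cur_min π.root hπ.1).trans ?_
  have h := EReal.coe_ennreal_le_coe_ennreal_iff.2 (hs.lo_root_le_primCost hP hπ)
  rwa [EReal.coe_ennreal_add, EReal.coe_ennreal_ofReal, max_eq_left (hs.lo_nonneg _ _)] at h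

theorem Invariant.lb_ne_top {s : AlgState E Yr} (hs : P.Invariant s) (hP : P.Admissible) :
    s.lb ≠ ⊤ := by
  obtain ⟨q, hq, hf⟩ := hP.exists_root_finite
  refine ((hs.lb_eq.le.trans (hs.cur_min q hq)).trans_lt ?_).ne
  rw [← EReal.coe_ennreal_toReal hf, ← EReal.coe_add]
  exact EReal.coe_lt_top _

theorem Invariant.lb_ne_bot {s : AlgState E Yr} (hs : P.Invariant s) : s.lb ≠ ⊥ := by
  rw [hs.lb_eq, EReal.add_ne_bot_iff]
  exact ⟨EReal.coe_ennreal_ne_bot _, EReal.coe_ne_bot _⟩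

/-- The incumbent is `ε`-optimal if the stopping criterion holds. -/
theorem Invariant.exists_epsOptimal {s : AlgState E Yr} (hs : P.Invariant s)
    (hO : P.ValidOracles O) (hP : P.Admissible) (hexact : P.ExactPenalty) {ε : ℝ} (hε : 0 ≤ ε)
    (h : s.ub - s.lb ≤ (ε : EReal)) : ∃ q, s.best = some q ∧ P.EpsOptimal ε q := by
  have h1 : s.ub ≤ ε + s.lb :=
    (EReal.sub_le_iff_le_add (.inl hs.lb_ne_bot) (.inl (hs.lb_ne_top hP))).1 h
  rcases hs.best with h2 | ⟨q, hq, hb, h2⟩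
  · rw [h2, top_le_iff] at h1
    exact absurd h1 (EReal.add_ne_top (EReal.coe_ne_top _) (hs.lb_ne_top hP))
  · refine ⟨q, hb, hq, ?_⟩
    have h3 := h2.trans (h1.trans (add_le_add le_rfl (hs.lb_le_vReg hO hP hexact)))
    rw [← EReal.coe_ennreal_le_coe_ennreal_iff, EReal.coe_ennreal_add, EReal.coe_ennreal_add,
      EReal.coe_ennreal_ofReal, max_eq_left hε, ← hP.ofReal_regVal (Nat.zero_le _),
      EReal.coe_ennreal_ofReal, max_eq_left (regVal_nonneg _ _), add_comm (P.vReg : EReal)]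
    exact h3

/-! ### Gaps and the number of iterations -/

/-- The gap of the approximations at `x` is at most `c`. -/
def GapLE (s : AlgState E Yr) (t : ℕ) (x : E t) (c : ℝ) : Prop :=
  s.hi t x ≤ ((s.lo t x + c : ℝ) : EReal)

theorem GapLE.mono {s : AlgState E Yr} {t : ℕ} {x : E t} {c c' : ℝ} (h : GapLE s t x c)
    (hc : c ≤ c') : GapLE s t x c' :=
  h.trans (EReal.coe_le_coe_iff.2 (by linarith))

/-- `hi` only decreases and `lo` only increases, so a gap once closed stays closed. -/
theorem GapLE.algRun (hO : P.ValidOracles O) (hP : P.Admissible) (hT : 1 ≤ P.T) {t : ℕ}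
    (ht : t < P.T) {x : E t} {c : ℝ} {i j : ℕ} (hij : i ≤ j) (h : GapLE (P.algRun O i) t x c) :
    GapLE (P.algRun O j) t x c := by
  induction j, hij using Nat.le_induction with
  | base => exact h
  | succ j hj ih =>
    have hs := hO.invariant_algRun hP hT j
    refine (newOver_le hs ht.le x).trans (ih.trans (EReal.coe_le_coe_iff.2 ?_))
    have := le_newUnder (i := j + 1) (O := O) hs ht.le x
    simp only [StagewiseProblem.algRun]
    linarith

/-- If the stopping criterion fails, then there is a large gap at the current root solution. -/
theorem Invariant.not_gapLE {s : AlgState E Yr} (hs : P.Invariant s) {ε : ℝ}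
    (h : (ε : EReal) < s.ub - s.lb) : ¬ GapLE s 0 s.cur.1 ε := by
  intro hg
  refine absurd h (not_lt.2 (EReal.sub_le_of_le_add ?_))
  refine (hs.ub_le.trans (add_le_add le_rfl hg)).trans_eq ?_
  rw [hs.lb_eq, EReal.coe_add, add_comm (ε : EReal), add_assoc]

/-- In an iteration that starts with a large gap at the root there is a stage at which the gap is
large while it is small at the next stage. -/
theorem Invariant.exists_stage {s : AlgState E Yr} (hs : P.Invariant s) (hT : 1 ≤ P.T) {ε : ℝ}
    (h : ¬ GapLE s 0 s.cur.1 ε) (i : ℕ) : ∃ t < P.T,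
      ¬ GapLE s t (fwdState O i s t) ((P.T - t) * (ε / P.T)) ∧
      GapLE s (t + 1) (fwdState O i s (t + 1)) ((P.T - (t + 1)) * (ε / P.T)) := by
  by_contra hcon
  push Not at hcon
  have hT0 : (P.T : ℝ) ≠ 0 := by exact_mod_cast (by omega : P.T ≠ 0)
  -- Without a stage where the gap drops below its threshold, a large gap would propagate from the
  -- root to stage `T`, where both approximations vanish.
  have key : ∀ t ≤ P.T, ¬ GapLE s t (fwdState O i s t) ((P.T - t) * (ε / P.T)) := by
    intro t
    induction t with
    | zero =>
      intro _
      have : ((P.T : ℝ) - (0 : ℕ)) * (ε / P.T) = ε := by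
        rw [Nat.cast_zero, sub_zero]
        field_simp
      rw [this]
      exact h
    | succ t ih =>
      intro ht
      have := hcon t ht (ih (Nat.le_of_succ_le ht))
      rwa [Nat.cast_succ]
  refine key P.T le_rfl ?_
  unfold GapLE
  rw [hs.hi_last, hs.lo_last, sub_self, zero_mul, add_zero, EReal.coe_zero]

/-- The number of iterations before the stopping criterion holds is bounded. -/
theorem ValidOracles.card_iterations_le [∀ t, FiniteDimensional ℝ (E t)] (hO : P.ValidOracles O)
    (hP : P.Admissible) (hT : 1 ≤ P.T) (hdual : P.DualBounds) {ε L D : ℝ} {d : ℕ} (hε : 0 < ε)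
    (hL : ∀ t < P.T, P.lipConst t ≤ L) (hD : ∀ t < P.T, enclosingDiam (P.stateSpace t) ≤ D)
    (hd : ∀ t < P.T, Module.finrank ℝ (E t) ≤ d) {N : ℕ}
    (hN : ∀ j < N, (ε : EReal) < (P.algRun O j).ub - (P.algRun O j).lb) :
    (N : ℝ) ≤ P.T * (1 + 2 * L * D * P.T / ε) ^ d := by
  classical
  have hTpos : (0 : ℝ) < P.T := by exact_mod_cast hT
  have hLpos : 0 < L := (hP.lipConst_pos hdual hT).trans_le (hL 0 hT)
  have hDnn : 0 ≤ D := (enclosingDiam_nonneg _).trans (hD 0 hT)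
  set δ := ε / P.T with hδ
  have hδpos : 0 < δ := div_pos hε hTpos
  have hinv := hO.invariant_algRun hP hT
  -- Index `j` stands for iteration `j + 1`, which starts from the variables `algRun O j`.
  set X : ℕ → (t : ℕ) → E t := fun j => fwdState O (j + 1) (P.algRun O j) with hX
  have hstage : ∀ j, ∃ t, j < N → t < P.T ∧
      ¬ GapLE (P.algRun O j) t (X j t) ((P.T - t) * δ) ∧
      GapLE (P.algRun O j) (t + 1) (X j (t + 1)) ((P.T - (t + 1)) * δ) := by
    intro j
    by_cases hj : j < N
    · obtain ⟨t, ht, h⟩ := (hinv j).exists_stage hT ((hinv j).not_gapLE (hN j hj)) (j + 1)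
      exact ⟨t, fun _ => ⟨ht, h⟩⟩
    · exact ⟨0, fun h => absurd h hj⟩
  choose τ hτ using hstage
  -- Within this distance the Lipschitz term `2 * L * r` costs exactly one threshold step `δ`.
  set r := δ / (2 * L) with hr
  have hrpos : 0 < r := by positivity
  have hmaps : ∀ j ∈ Finset.range N, τ j ∈ Finset.range P.T := fun j hj =>
    Finset.mem_range.2 (hτ j (Finset.mem_range.1 hj)).1
  have hfar : ∀ t < P.T, ∀ j k, j < k → k < N → τ j = t → τ k = t → r ≤ ‖X k t - X j t‖ := by
    rintro t ht j k hjk hkN hj hk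
    have h1 := (hτ j (hjk.trans hkN)).2.2
    have h2 := (hτ k hkN).2.1
    rw [hj] at h1
    rw [hk] at h2
    by_contra hlt
    push Not at hlt
    -- The earlier iteration closes the gap near `X j t`. This persists until iteration `k + 1`
    -- starts, and so contradicts the large gap there.
    have h3 : GapLE (P.algRun O (j + 1)) t (X k t) _ :=
      newOver_le_newUnder_add_of_fwdState hO hP (hinv j) hdual ht h1
        (fwdState_mem hO hP (hinv k) t ht)
    refine h2 ((h3.algRun hO hP hT ht hjk).mono ?_)
    have h4 : 2 * P.lipConst t * ‖X k t - X j t‖ ≤ δ := by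
      calc 2 * P.lipConst t * ‖X k t - X j t‖ ≤ 2 * L * r := by
            have := hL t ht
            gcongr
        _ = δ := by rw [hr]; field_simp
    change _ + 2 * P.lipConst t * ‖X k t - X j t‖ ≤ _
    linarith
  have hfib : ∀ t ∈ Finset.range P.T, (((Finset.range N).filter fun j => τ j = t).card : ℝ) ≤
      (1 + 2 * L * D * P.T / ε) ^ d := by
    intro t ht
    rw [Finset.mem_range] at ht
    refine (card_le_of_separated_of_enclosingDiam (hP.isBounded_stateSpace t ht) _
      (fun j => X j t) hrpos (fun j _ => fwdState_mem hO hP (hinv j) t ht) ?_).trans ?_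
    · intro j hj k hk hjk
      rw [Finset.mem_filter, Finset.mem_range] at hj hk
      rcases hjk.lt_or_gt with h | h
      · rw [norm_sub_rev]
        exact hfar t ht j k h hk.1 hj.2 hk.2
      · exact hfar t ht k j h hj.1 hk.2 hj.2
    · have e : 2 * L * D * P.T / ε = D / r := by
        rw [hr, hδ]
        field_simp
      rw [e]
      have h1 : enclosingDiam (P.stateSpace t) / r ≤ D / r := by
        gcongr
        exact hD t ht
      have h2 : 0 ≤ enclosingDiam (P.stateSpace t) / r :=
        div_nonneg (enclosingDiam_nonneg _) hrpos.le
      calc (1 + enclosingDiam (P.stateSpace t) / r) ^ Module.finrank ℝ (E t)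
          ≤ (1 + D / r) ^ Module.finrank ℝ (E t) := by gcongr
        _ ≤ (1 + D / r) ^ d := pow_le_pow_right₀ (by linarith) (hd t ht)
  have hcard := Finset.card_eq_sum_card_fiberwise hmaps
  rw [Finset.card_range] at hcard
  calc (N : ℝ) = ∑ t ∈ Finset.range P.T,
        (((Finset.range N).filter fun j => τ j = t).card : ℝ) := by exact_mod_cast hcard
    _ ≤ ∑ _t ∈ Finset.range P.T, (1 + 2 * L * D * P.T / ε) ^ d := Finset.sum_le_sum hfib
    _ = P.T * (1 + 2 * L * D * P.T / ε) ^ d := by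
      rw [Finset.sum_const, Finset.card_range, nsmul_eq_mul]

end StagewiseProblem

end

theorem mainTheorem2
    {E : ℕ → Type*} {C : ℕ → Type*} {Yr : Type*} {Y : (t : ℕ) → C t → Type*}
    [∀ t, NormedAddCommGroup (E t)] [∀ t, NormedSpace ℝ (E t)]
    [∀ t, FiniteDimensional ℝ (E t)] [∀ t, Fintype (C t)]
    [NormedAddCommGroup Yr] [NormedSpace ℝ Yr] [FiniteDimensional ℝ Yr]
    [∀ t m, NormedAddCommGroup (Y t m)] [∀ t m, NormedSpace ℝ (Y t m)]
    [∀ t m, FiniteDimensional ℝ (Y t m)]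
    (P : StagewiseProblem E C Yr Y) (hT : 1 ≤ P.T)
    (hP : P.Admissible) (hexact : P.ExactPenalty) (hdual : P.DualBounds)
    (O : Oracles E C Yr Y) (hO : P.ValidOracles O)
    (ε L D : ℝ) (d : ℕ) (hε : 0 < ε)
    (hL : ∀ t < P.T, P.lipConst t ≤ L)
    (hD : ∀ t < P.T, enclosingDiam (P.stateSpace t) ≤ D)
    (hd : ∀ t < P.T, Module.finrank ℝ (E t) ≤ d) :
    (∃ i : ℕ, P.TerminatesAt O ε i ∧
      (i : ℝ) ≤ P.T * (1 + 2 * L * D * P.T / ε) ^ d ∧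
      ∃ q, (P.algRun O i).best = some q ∧ P.EpsOptimal ε q) ∧
    Asymptotics.IsBigO Filter.atTop
      (fun N : ℕ => (N : ℝ) * (1 + 2 * L * D * N / ε) ^ d)
      (fun N : ℕ => (N : ℝ) ^ (d + 1)) := by
  refine ⟨?_, isBigO_mul_one_add_div_pow (2 * L * D) ε d⟩
  have hbound := fun N hN => hO.card_iterations_le hP hT hdual hε hL hD hd (N := N) hN
  have hex : ∃ i, (P.algRun O i).ub - (P.algRun O i).lb ≤ (ε : EReal) := by
    by_contra hcon
    push Not at hcon
    -- Termination follows from the same count: a run that never stops would violate the bound for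
    -- large `N`.
    obtain ⟨N, hN⟩ := exists_nat_gt (P.T * (1 + 2 * L * D * P.T / ε) ^ d)
    exact absurd (hbound N fun j _ => hcon j) (not_le.2 hN)
  classical
  have hmin : ∀ j < Nat.find hex, (ε : EReal) < (P.algRun O j).ub - (P.algRun O j).lb :=
    fun j hj => not_le.1 (Nat.find_min hex hj)
  exact ⟨Nat.find hex, ⟨Nat.find_spec hex, hmin⟩, hbound _ hmin,
    (hO.invariant_algRun hP hT _).exists_epsOptimal hO hP hexact hε.le (Nat.find_spec hex)⟩
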